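/- Let $k$ be an algebraically closed field of characteristic $0$ and let $\mathcal C$ be a braided fusion category over $k$ (a semisimple $k$-linear abelian rigid monoidal category with bilinear tensor product, finitely many isomorphism classes of simple objects, finite-dimensional Hom-spaces, simple unit object $I$, and a braiding $c$). Write $M^*$ for the dual of $M$, with evaluation $\mathrm{ev}_M\colon M^*\otimes M\to I$. A non-singular quadratic object is a pair $(M,b)$ with $b\colon M\otimes M\to I$ such that $b\circ c_{M,M}=b$ and such that the morphism $M\to M^*$ corresponding to $b$ by duality is an isomorphism; an isometry $(M,b)\to(M',b')$ is an isomorphism $f\colon M\to M'$ with $b'\circ(f\otimes f)=b$. Let $K_0(\mathcal Q)$ be the abelian group generated by the isometry classes of non-singular quadratic objects with the relations $[(M\oplus M',b\oplus b')]=[(M,b)]+[(M',b')]$. An object $M$ is weakly symmetric if $\mathrm{ev}_M\circ c_{M,M^*}\circ c_{M^*,M}=\mathrm{ev}_M$; for such $M$ the hyperbolic object $\mathcal H(M)$ is $M\oplus M^*$ with the form that is $0$ on $M\otimes M$ and on $M^*\otimes M^*$, is $\mathrm{ev}_M$ on $M^*\otimes M$, and is $\mathrm{ev}_M\circ c_{M,M^*}$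 on $M\otimes M^*$. The Witt group $W(\mathcal C)$ is the quotient of $K_0(\mathcal Q)$ by the subgroup generated by the classes of all $\mathcal H(M)$, $M$ weakly symmetric. Let $(X_i)_i$ be representatives of the isomorphism classes of simple objects, let $i^*$ be the index such that $X_{i^*}$ is dual to $X_i$ (so $i^{**}=i$), and choose dual pairs with evaluations $\mathrm{ev}_i\colon X_{i^*}\otimes X_i\to I$. Then there are unique scalars $d_i\in k$ with $\mathrm{ev}_i\circ c_{X_i,X_{i^*}}=d_i\,\mathrm{ev}_{i^*}$ for all $i$. Put $G=\{i : i=i^*,\ d_i=1\}$. 1. $W(\mathcal C)$ is a $\mathbb Z/2$-vector space with basis $([X_i])_{i\in G}$, where $[X_i]$ is the class of $(X_i,\mathrm{ev}_i)$ (with $X_{i^*}=X_i$); it is also the class of $(X_i,b)$ for every non-singular symmetric form $b$ on $X_i$. 2. Suppose that the braiding is symmetric, and let $W(\mathcal C)$ carry the biadditive product with $[(M,b)]\cdot[(M',b')]=[(M\otimes M',b\,\square\,b')]$, where $b\,\square\,b'=(b\otimes b')\circ(1_M\otimes c_{M',M}\otimes 1_{M'})$. Let $K_0(\mathcal C)$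 be the Grothendieck ring of $\mathcal C$. There are additive maps $\iota\colon W(\mathcal C)\to K_0(\mathcal C)\otimes_{\mathbb Z}\mathbb Z/2$ and $p\colon K_0(\mathcal C)\otimes_{\mathbb Z}\mathbb Z/2\to W(\mathcal C)$ such that $\iota$ sends the basis element $[X_i]$ to the class of $X_i$ for each $i\in G$, $p\circ\iota=\mathrm{id}$, the kernel of $p$ is spanned by the classes of the $X_j$ with $j\notin G$, and $$x\cdot y=p(\iota(x)\,\iota(y))\qquad\text{for all }x,y\in W(\mathcal C).$$ -/

import Mathlib

open CategoryTheory CategoryTheory.Limits CategoryTheory.MonoidalCategory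
open scoped TensorProduct

attribute [local instance] CategoryTheory.Abelian.hasFiniteBiproducts

namespace BraidedWitt

universe v u w

/-! ### `K₀` of a collection of objects with a product -/

section KZero

variable {A : Type w}

/-- The relations of the Grothendieck group of objects `A` with isomorphism relation `r` and
product operation `s`: `[a] = [b]` if `r a b`, and `[s a b] = [a] + [b]`. -/
def K0Relations (r : A → A → Prop) (s : A → A → A) : AddSubgroup (FreeAbelianGroup A) :=
  AddSubgroup.closure
    ({x | ∃ a b, r a b ∧ x = FreeAbelianGroup.of a - FreeAbelianGroup.of b} ∪
     {x | ∃ a b, x = FreeAbelianGroup.of (s a b) - (FreeAbelianGroup.of a + FreeAbelianGroup.of b)})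

/-- The Grothendieck group: the abelian group generated by the isomorphism classes of objects
subject to `[s a b] = [a] + [b]`. -/
abbrev KZero (r : A → A → Prop) (s : A → A → A) : Type w :=
  FreeAbelianGroup A ⧸ K0Relations r s

variable {r : A → A → Prop} {s : A → A → A}

/-- The class of an object in the Grothendieck group. -/
def KZero.cls (r : A → A → Prop) (s : A → A → A) (a : A) : KZero r s :=
  QuotientAddGroup.mk' (K0Relations r s) (FreeAbelianGroup.of a)

lemma KZero.cls_eq {a b : A} (h : r a b) : KZero.cls r s a = KZero.cls r s b := by
  refine (QuotientAddGroup.eq_iff_sub_mem).2 ?_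
  exact AddSubgroup.subset_closure (Or.inl ⟨a, b, h, rfl⟩)

lemma KZero.cls_prod (a b : A) :
    KZero.cls r s (s a b) = KZero.cls r s a + KZero.cls r s b := by
  have : KZero.cls r s a + KZero.cls r s b =
      QuotientAddGroup.mk' (K0Relations r s) (FreeAbelianGroup.of a + FreeAbelianGroup.of b) := by
    rw [map_add]; rfl
  rw [this]
  refine (QuotientAddGroup.eq_iff_sub_mem).2 ?_
  exact AddSubgroup.subset_closure (Or.inr ⟨a, b, rfl⟩)

/-- A map on objects that respects isomorphism and product induces a map on `K₀`. -/
def KZero.lift {G : Type*} [AddCommGroup G] (f : A → G) (hr : ∀ a b, r a b → f a = f b)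
    (hs : ∀ a b, f (s a b) = f a + f b) : KZero r s →+ G :=
  QuotientAddGroup.lift (K0Relations r s) (FreeAbelianGroup.lift f) (by
    refine (AddSubgroup.closure_le _).2 ?_
    rintro x (⟨a, b, h, rfl⟩ | ⟨a, b, rfl⟩)
    · simp [hr a b h]
    · simp [hs a b])

@[simp] lemma KZero.lift_cls {G : Type*} [AddCommGroup G] (f : A → G)
    (hr : ∀ a b, r a b → f a = f b) (hs : ∀ a b, f (s a b) = f a + f b) (a : A) :
    KZero.lift (r := r) (s := s) f hr hs (KZero.cls r s a) = f a := by
  change FreeAbelianGroup.lift f (FreeAbelianGroup.of a) = f a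
  simp

lemma KZero.hom_ext {G : Type*} [AddCommGroup G] {f g : KZero r s →+ G}
    (h : ∀ a, f (KZero.cls r s a) = g (KZero.cls r s a)) : f = g := by
  apply QuotientAddGroup.addMonoidHom_ext
  ext a
  exact h a

/-- A binary operation on objects compatible with isomorphisms and distributive over the product
induces a biadditive product on `K₀`. -/
def KZero.mul (m : A → A → A) (hl : ∀ a a' b, r a a' → r (m a b) (m a' b))
    (hr : ∀ a b b', r b b' → r (m a b) (m a b'))
    (dl : ∀ a a' b, r (m (s a a') b) (s (m a b) (m a' b)))
    (dr : ∀ a b b', r (m a (s b b')) (s (m a b) (m a b'))) :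
    KZero r s →+ KZero r s →+ KZero r s :=
  KZero.lift
    (fun a => KZero.lift (fun b => KZero.cls r s (m a b))
      (fun b b' h => KZero.cls_eq (hr a b b' h))
      (fun b b' => by rw [KZero.cls_eq (dr a b b'), KZero.cls_prod]))
    (fun a a' h => KZero.hom_ext fun b => by simpa using KZero.cls_eq (hl a a' b h))
    (fun a a' => KZero.hom_ext fun b => by
      simp only [KZero.lift_cls, AddMonoidHom.add_apply]
      rw [KZero.cls_eq (dl a a' b), KZero.cls_prod])

@[simp] lemma KZero.mul_cls (m : A → A → A) (hl hr dl dr) (a b : A) :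
    KZero.mul (r := r) (s := s) m hl hr dl dr (KZero.cls r s a) (KZero.cls r s b) =
      KZero.cls r s (m a b) := by
  simp [KZero.mul]

end KZero

/-! ### The Grothendieck ring of a category -/

section GrothendieckRing

variable (C : Type u) [Category.{v} C] [Preadditive C] [HasBinaryBiproducts C]

/-- `K₀(C)`: generated by isomorphism classes with `[X ⊞ Y] = [X] + [Y]`.  (In a semisimple
category every short exact sequence splits.) -/
noncomputable def K0 : Type u := KZero (fun X Y : C => Nonempty (X ≅ Y)) (fun X Y => X ⊞ Y)

noncomputable instance : AddCommGroup (K0 C) :=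
  inferInstanceAs (AddCommGroup (KZero (fun X Y : C => Nonempty (X ≅ Y)) (fun X Y => X ⊞ Y)))

variable {C} in
/-- The class of an object in `K₀(C)`. -/
noncomputable def K0.cls (X : C) : K0 C := KZero.cls (fun X Y : C => Nonempty (X ≅ Y)) (fun X Y => X ⊞ Y) X

variable {C} in
lemma K0.cls_eq {X Y : C} (e : X ≅ Y) : K0.cls X = K0.cls Y := KZero.cls_eq ⟨e⟩

variable {C} in
lemma K0.hom_ext {G : Type*} [AddCommGroup G] {f g : K0 C →+ G}
    (h : ∀ X : C, f (K0.cls X) = g (K0.cls X)) : f = g := KZero.hom_ext h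

variable [MonoidalCategory C] [MonoidalPreadditive C]

variable {C} in
/-- Tensoring distributes over binary biproducts. -/
noncomputable def rightDistrib (X Y Z : C) : (X ⊞ Y) ⊗ Z ≅ (X ⊗ Z) ⊞ (Y ⊗ Z) where
  hom := biprod.lift (biprod.fst ▷ Z) (biprod.snd ▷ Z)
  inv := biprod.desc (biprod.inl ▷ Z) (biprod.inr ▷ Z)
  hom_inv_id := by
    rw [biprod.lift_desc, ← comp_whiskerRight, ← comp_whiskerRight,
      ← MonoidalPreadditive.add_whiskerRight, biprod.total, id_whiskerRight]
  inv_hom_id := by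
    ext <;> simp [← comp_whiskerRight]

variable {C} in
/-- Tensoring distributes over binary biproducts. -/
noncomputable def leftDistrib (Z X Y : C) : Z ⊗ (X ⊞ Y) ≅ (Z ⊗ X) ⊞ (Z ⊗ Y) where
  hom := biprod.lift (Z ◁ biprod.fst) (Z ◁ biprod.snd)
  inv := biprod.desc (Z ◁ biprod.inl) (Z ◁ biprod.inr)
  hom_inv_id := by
    rw [biprod.lift_desc, ← whiskerLeft_comp, ← whiskerLeft_comp,
      ← MonoidalPreadditive.whiskerLeft_add, biprod.total, whiskerLeft_id]
  inv_hom_id := by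
    ext <;> simp [← whiskerLeft_comp]

/-- The product `[X] * [Y] = [X ⊗ Y]` on `K₀(C)`. -/
noncomputable def K0.mulHom : K0 C →+ K0 C →+ K0 C :=
  KZero.mul (fun X Y : C => X ⊗ Y)
    (fun _ _ b ⟨e⟩ => ⟨whiskerRightIso e b⟩)
    (fun a _ _ ⟨e⟩ => ⟨whiskerLeftIso a e⟩)
    (fun a a' b => ⟨rightDistrib a a' b⟩)
    (fun a b b' => ⟨leftDistrib a b b'⟩)

lemma K0.mulHom_cls (X Y : C) : K0.mulHom C (K0.cls X) (K0.cls Y) = K0.cls (X ⊗ Y) :=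
  KZero.mul_cls _ _ _ _ _ X Y

/-- The Grothendieck ring of `C`. -/
noncomputable instance : Ring (K0 C) :=
  { (inferInstance : AddCommGroup (K0 C)) with
    mul := fun x y => K0.mulHom C x y
    one := K0.cls (𝟙_ C)
    left_distrib := fun x y z => map_add (K0.mulHom C x) y z
    right_distrib := fun x y z => by
      change K0.mulHom C (x + y) z = K0.mulHom C x z + K0.mulHom C y z
      rw [map_add]; rfl
    zero_mul := fun x => by
      change K0.mulHom C 0 x = 0
      rw [map_zero]; rfl
    mul_zero := fun x => map_zero (K0.mulHom C x)
    one_mul := fun x => by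
      have : K0.mulHom C (K0.cls (𝟙_ C)) = AddMonoidHom.id _ := K0.hom_ext fun X => by
        rw [K0.mulHom_cls]; exact K0.cls_eq (λ_ X)
      exact DFunLike.congr_fun this x
    mul_one := fun x => by
      have : (K0.mulHom C).flip (K0.cls (𝟙_ C)) = AddMonoidHom.id _ := K0.hom_ext fun X => by
        rw [AddMonoidHom.flip_apply, K0.mulHom_cls]; exact K0.cls_eq (ρ_ X)
      exact DFunLike.congr_fun this x
    mul_assoc := fun x y z => by
      have h1 : ∀ (X Y : C), K0.mulHom C (K0.cls (X ⊗ Y)) =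
          (K0.mulHom C (K0.cls X)).comp (K0.mulHom C (K0.cls Y)) := fun X Y =>
        K0.hom_ext fun Z => by
          simp only [AddMonoidHom.comp_apply, K0.mulHom_cls]; exact K0.cls_eq (α_ X Y Z)
      have h2 : ∀ X : C, ((K0.mulHom C).comp (K0.mulHom C (K0.cls X))) =
          (AddMonoidHom.compHom (K0.mulHom C (K0.cls X))).comp (K0.mulHom C) := fun X =>
        K0.hom_ext fun Y => by
          simp only [AddMonoidHom.comp_apply, K0.mulHom_cls, h1]; rfl
      have h4 : (AddMonoidHom.flip (K0.mulHom C) z).comp ((K0.mulHom C).flip y) =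
          (K0.mulHom C).flip (K0.mulHom C y z) := K0.hom_ext fun X => by
        have := DFunLike.congr_fun (DFunLike.congr_fun (h2 X) y) z
        simpa using this
      exact DFunLike.congr_fun h4 x }

end GrothendieckRing

/-! ### Quadratic objects -/

section Forms

variable {C : Type u} [Category.{v} C] [MonoidalCategory C]

/-- The map `Hom(M ⊗ M, I) → Hom(M, M*)` given by the duality adjunction. -/
def adj [RightRigidCategory C] {M : C} (b : M ⊗ M ⟶ 𝟙_ C) : M ⟶ Mᘁ :=
  tensorRightHomEquiv M M Mᘁ (𝟙_ C) b ≫ (λ_ Mᘁ).hom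

/-- A bilinear form is non-singular if the corresponding map `M ⟶ M*` is an isomorphism. -/
def IsNonsingular [RightRigidCategory C] {M : C} (b : M ⊗ M ⟶ 𝟙_ C) : Prop := IsIso (adj b)

/-- `b` is symmetric if `b ∘ c_{M,M} = b`. -/
def IsSymmetricForm [BraidedCategory C] {M : C} (b : M ⊗ M ⟶ 𝟙_ C) : Prop :=
  (β_ M M).hom ≫ b = b

/-- `M` is weakly symmetric if `ev_M ∘ c_{M,M*} ∘ c_{M*,M} = ev_M`. -/
def IsWeaklySymmetric [BraidedCategory C] [RightRigidCategory C] (M : C) : Prop :=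
  (β_ Mᘁ M).hom ≫ (β_ M Mᘁ).hom ≫ ε_ M Mᘁ = ε_ M Mᘁ

variable (C) in
/-- The braiding is a symmetry. -/
def IsSymmetricBraiding [BraidedCategory C] : Prop :=
  ∀ X Y : C, (β_ X Y).hom ≫ (β_ Y X).hom = 𝟙 (X ⊗ Y)

/-- Auxiliary criterion: a pairing `e : Y ⊗ X ⟶ I` is perfect if `f ↦ e ∘ (f ⊗ X)` is a bijection
`Hom(Z, Y) → Hom(Z ⊗ X, I)` for all `Z`. -/
def IsPerfect {Y X : C} (e : Y ⊗ X ⟶ 𝟙_ C) : Prop :=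
  ∀ Z : C, Function.Bijective (fun f : Z ⟶ Y => f ▷ X ≫ e)

lemma isPerfect_evaluation (X Y : C) [ExactPairing X Y] : IsPerfect (ε_ X Y) := by
  intro Z
  have h : (fun f : Z ⟶ Y => f ▷ X ≫ ε_ X Y) =
      fun f => (tensorRightHomEquiv Z X Y (𝟙_ C)).symm (f ≫ (λ_ Y).inv) := by
    funext f
    rw [tensorRightHomEquiv_symm_naturality]
    congr 1
    simp [tensorRightHomEquiv, ← unitors_equal]
  rw [h]
  refine (tensorRightHomEquiv Z X Y (𝟙_ C)).symm.bijective.comp ?_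
  exact ((λ_ Y).symm.homToEquiv (Z := Z)).bijective

lemma eq_adj [RightRigidCategory C] {M : C} (b : M ⊗ M ⟶ 𝟙_ C) : b = adj b ▷ M ≫ ε_ M Mᘁ := by
  apply (tensorRightHomEquiv M M Mᘁ (𝟙_ C)).injective
  rw [tensorRightHomEquiv_whiskerRight_comp_evaluation]
  simp [adj]

lemma isPerfect_comp_iff {Y Y' X : C} {e : Y ⊗ X ⟶ 𝟙_ C} (he : IsPerfect e) (f : Y' ⟶ Y) :
    IsPerfect (f ▷ X ≫ e) ↔ IsIso f := by
  constructor
  · intro h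
    have key : ∀ Z : C, Function.Bijective (fun g : Z ⟶ Y' => g ≫ f) := by
      intro Z
      have h1 := h Z
      have : (fun g : Z ⟶ Y' => g ▷ X ≫ f ▷ X ≫ e) =
          (fun g : Z ⟶ Y => g ▷ X ≫ e) ∘ (fun g : Z ⟶ Y' => g ≫ f) := by
        funext g; simp
      rw [this] at h1
      exact ((he Z).of_comp_iff' _).1 h1
    obtain ⟨g, hg⟩ := (key Y).2 (𝟙 Y)
    refine ⟨g, (key Y').1 ?_, hg⟩
    simp only at hg ⊢
    simp [hg]
  · intro h Z
    have : (fun g : Z ⟶ Y' => g ▷ X ≫ f ▷ X ≫ e) =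
        (fun g : Z ⟶ Y => g ▷ X ≫ e) ∘ (fun g : Z ⟶ Y' => g ≫ f) := by
      funext g; simp
    rw [this]
    exact (he Z).comp ((asIso f).homToEquiv (Z := Z)).bijective

lemma isNonsingular_iff [RightRigidCategory C] {M : C} (b : M ⊗ M ⟶ 𝟙_ C) :
    IsNonsingular b ↔ IsPerfect b := by
  rw [IsNonsingular, ← isPerfect_comp_iff (isPerfect_evaluation M Mᘁ) (adj b), ← eq_adj]

lemma isPerfect_swap_evaluation [BraidedCategory C] [RightRigidCategory C] (M : C) :
    IsPerfect ((β_ M Mᘁ).hom ≫ ε_ M Mᘁ) :=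
  @isPerfect_evaluation C _ _ Mᘁ M (BraidedCategory.exactPairing_swap M Mᘁ)

end Forms

section Quadratic

set_option linter.unusedSectionVars false

variable {C : Type u} [Category.{v} C] [Preadditive C] [HasBinaryBiproducts C]
  [MonoidalCategory C] [MonoidalPreadditive C]

lemma isPerfect_biprod {Y Y' X X' : C} {e : Y ⊗ X ⟶ 𝟙_ C} {e' : Y' ⊗ X' ⟶ 𝟙_ C}
    (he : IsPerfect e) (he' : IsPerfect e') :
    IsPerfect (((biprod.fst : Y ⊞ Y' ⟶ Y) ⊗ₘ (biprod.fst : X ⊞ X' ⟶ X)) ≫ e +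
      (biprod.snd ⊗ₘ biprod.snd) ≫ e') := by
  have e1 : ∀ {Z : C} (f : Z ⟶ Y ⊞ Y'), Z ◁ biprod.inl ≫ f ▷ (X ⊞ X') ≫
      (((biprod.fst : Y ⊞ Y' ⟶ Y) ⊗ₘ (biprod.fst : X ⊞ X' ⟶ X)) ≫ e +
      (biprod.snd ⊗ₘ biprod.snd) ≫ e') = (f ≫ biprod.fst) ▷ X ≫ e := by
    intro Z f
    have a1 : Z ◁ (biprod.inl : X ⟶ X ⊞ X') ≫ f ▷ (X ⊞ X') ≫ (biprod.fst ⊗ₘ biprod.fst) =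
        (f ≫ biprod.fst) ▷ X := by
      simp only [← id_tensorHom, ← tensorHom_id, tensorHom_comp_tensorHom]; simp
    have a2 : Z ◁ (biprod.inl : X ⟶ X ⊞ X') ≫ f ▷ (X ⊞ X') ≫ (biprod.snd ⊗ₘ biprod.snd) = 0 := by
      simp only [← id_tensorHom, ← tensorHom_id, tensorHom_comp_tensorHom]; simp
    rw [Preadditive.comp_add, Preadditive.comp_add, reassoc_of% a1, reassoc_of% a2, zero_comp,
      add_zero]
  have e2 : ∀ {Z : C} (f : Z ⟶ Y ⊞ Y'), Z ◁ biprod.inr ≫ f ▷ (X ⊞ X') ≫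
      (((biprod.fst : Y ⊞ Y' ⟶ Y) ⊗ₘ (biprod.fst : X ⊞ X' ⟶ X)) ≫ e +
      (biprod.snd ⊗ₘ biprod.snd) ≫ e') = (f ≫ biprod.snd) ▷ X' ≫ e' := by
    intro Z f
    have a1 : Z ◁ (biprod.inr : X' ⟶ X ⊞ X') ≫ f ▷ (X ⊞ X') ≫ (biprod.snd ⊗ₘ biprod.snd) =
        (f ≫ biprod.snd) ▷ X' := by
      simp only [← id_tensorHom, ← tensorHom_id, tensorHom_comp_tensorHom]; simp
    have a2 : Z ◁ (biprod.inr : X' ⟶ X ⊞ X') ≫ f ▷ (X ⊞ X') ≫ (biprod.fst ⊗ₘ biprod.fst) = 0 := by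
      simp only [← id_tensorHom, ← tensorHom_id, tensorHom_comp_tensorHom]; simp
    rw [Preadditive.comp_add, Preadditive.comp_add, reassoc_of% a1, reassoc_of% a2, zero_comp,
      zero_add]
  intro Z
  constructor
  · intro f g h
    have h : f ▷ (X ⊞ X') ≫ _ = g ▷ (X ⊞ X') ≫ _ := h
    ext
    · apply (he Z).1
      change (f ≫ biprod.fst) ▷ X ≫ e = (g ≫ biprod.fst) ▷ X ≫ e
      rw [← e1, ← e1, h]
    · apply (he' Z).1
      change (f ≫ biprod.snd) ▷ X' ≫ e' = (g ≫ biprod.snd) ▷ X' ≫ e'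
      rw [← e2, ← e2, h]
  · intro g
    obtain ⟨f₁, h₁⟩ := (he Z).2 (Z ◁ biprod.inl ≫ g)
    obtain ⟨f₂, h₂⟩ := (he' Z).2 (Z ◁ biprod.inr ≫ g)
    simp only at h₁ h₂
    refine ⟨biprod.lift f₁ f₂, ?_⟩
    have ht : 𝟙 (Z ⊗ (X ⊞ X')) = Z ◁ biprod.fst ≫ Z ◁ biprod.inl +
        Z ◁ biprod.snd ≫ Z ◁ biprod.inr := by
      rw [← whiskerLeft_comp, ← whiskerLeft_comp, ← MonoidalPreadditive.whiskerLeft_add,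
        biprod.total, whiskerLeft_id]
    change biprod.lift f₁ f₂ ▷ (X ⊞ X') ≫ _ = g
    rw [← Category.id_comp (biprod.lift f₁ f₂ ▷ (X ⊞ X') ≫ _), ← Category.id_comp g, ht,
      Preadditive.add_comp, Preadditive.add_comp, Category.assoc, Category.assoc, e1, e2,
      Category.assoc, Category.assoc, biprod.lift_fst, biprod.lift_snd, h₁, h₂]

variable [BraidedCategory C] [RightRigidCategory C]

/-- A non-singular symmetric bilinear form on `M`. -/
structure QForm (M : C) where
  /-- the bilinear form -/
  form : M ⊗ M ⟶ 𝟙_ C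
  symm : IsSymmetricForm form
  nonsing : IsNonsingular form

variable (C) in
/-- Non-singular quadratic objects `(M, b)`. -/
structure QuadObj where
  /-- the underlying object -/
  obj : C
  /-- the form -/
  q : QForm obj

/-- `Q` and `Q'` are isometric: there is an isomorphism `e` with `b' ∘ (e ⊗ e) = b`. -/
def Isometric (Q Q' : QuadObj C) : Prop :=
  ∃ e : Q.obj ≅ Q'.obj, (e.hom ⊗ₘ e.hom) ≫ Q'.q.form = Q.q.form

/-- The orthogonal sum `(M ⊕ M', b ⊕ b')`. -/
noncomputable def perp (Q Q' : QuadObj C) : QuadObj C where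
  obj := Q.obj ⊞ Q'.obj
  q :=
    { form := (biprod.fst ⊗ₘ biprod.fst) ≫ Q.q.form + (biprod.snd ⊗ₘ biprod.snd) ≫ Q'.q.form
      symm := by
        have h1 := Q.q.symm
        have h2 := Q'.q.symm
        unfold IsSymmetricForm at *
        rw [Preadditive.comp_add, ← BraidedCategory.braiding_naturality_assoc,
          ← BraidedCategory.braiding_naturality_assoc, h1, h2]
      nonsing := (isNonsingular_iff _).2 (isPerfect_biprod ((isNonsingular_iff _).1 Q.q.nonsing)
        ((isNonsingular_iff _).1 Q'.q.nonsing)) }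

/-- The form of the hyperbolic object on `M ⊕ M*`: zero on `M ⊗ M` and `M* ⊗ M*`, `ev_M` on
`M* ⊗ M`, and `ev_M ∘ c_{M,M*}` on `M ⊗ M*`. -/
noncomputable def hypForm (M : C) : (M ⊞ Mᘁ) ⊗ (M ⊞ Mᘁ) ⟶ 𝟙_ C :=
  (biprod.snd ⊗ₘ biprod.fst) ≫ ε_ M Mᘁ + (biprod.fst ⊗ₘ biprod.snd) ≫ (β_ M Mᘁ).hom ≫ ε_ M Mᘁ

/-- The hyperbolic object `H(M) = (M ⊕ M*, b_M)` of a weakly symmetric object. -/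
noncomputable def hyp (M : C) (hM : IsWeaklySymmetric M) : QuadObj C where
  obj := M ⊞ Mᘁ
  q :=
    { form := hypForm M
      symm := by
        unfold IsWeaklySymmetric at hM
        unfold IsSymmetricForm hypForm
        rw [Preadditive.comp_add, ← BraidedCategory.braiding_naturality_assoc,
          ← BraidedCategory.braiding_naturality_assoc, hM, add_comm]
      nonsing := by
        rw [isNonsingular_iff]
        have h := isPerfect_biprod (isPerfect_evaluation M Mᘁ) (isPerfect_swap_evaluation M)
        have h2 := (isPerfect_comp_iff h (biprod.braiding M Mᘁ).hom).2 inferInstance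
        have a1 : (biprod.braiding M Mᘁ).hom ▷ (M ⊞ Mᘁ) ≫ (biprod.fst ⊗ₘ biprod.fst) =
            ((biprod.snd : M ⊞ Mᘁ ⟶ Mᘁ) ⊗ₘ (biprod.fst : M ⊞ Mᘁ ⟶ M)) := by
          rw [← tensorHom_id, tensorHom_comp_tensorHom]; simp
        have a2 : (biprod.braiding M Mᘁ).hom ▷ (M ⊞ Mᘁ) ≫ (biprod.snd ⊗ₘ biprod.snd) =
            ((biprod.fst : M ⊞ Mᘁ ⟶ M) ⊗ₘ (biprod.snd : M ⊞ Mᘁ ⟶ Mᘁ)) := by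
          rw [← tensorHom_id, tensorHom_comp_tensorHom]; simp
        rwa [Preadditive.comp_add, reassoc_of% a1, reassoc_of% a2] at h2 }

variable (C) in
/-- `K₀` of the category of non-singular quadratic objects and isometries, with product `⊥`. -/
noncomputable abbrev K0Quad : Type (max u v) := KZero (Isometric (C := C)) perp

variable (C) in
/-- The image of `K₀(H)`: the subgroup generated by the classes of the hyperbolic objects. -/
noncomputable def hypSubgroup : AddSubgroup (K0Quad C) :=
  AddSubgroup.closure {x | ∃ (M : C) (hM : IsWeaklySymmetric M),
    x = KZero.cls Isometric perp (hyp M hM)}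

variable (C) in
/-- The Witt group `W(C) = K₀(Q) / Im K₀(H)`. -/
noncomputable abbrev Witt : Type (max u v) := K0Quad C ⧸ hypSubgroup C

/-- The class of a non-singular quadratic object in the Witt group. -/
noncomputable def Witt.cls (Q : QuadObj C) : Witt C :=
  QuotientAddGroup.mk' (hypSubgroup C) (KZero.cls Isometric perp Q)

/-! ### The product on the Witt group of a symmetric category -/

/-- The pairing `e □ e'` : exchange the two middle factors and apply `e ⊗ e'`. -/
def boxPairing {Y₁ Y₂ X₁ X₂ : C} (e : Y₁ ⊗ X₁ ⟶ 𝟙_ C) (e' : Y₂ ⊗ X₂ ⟶ 𝟙_ C) :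
    (Y₁ ⊗ Y₂) ⊗ (X₁ ⊗ X₂) ⟶ 𝟙_ C :=
  tensorμ Y₁ Y₂ X₁ X₂ ≫ (e ⊗ₘ e') ≫ (λ_ (𝟙_ C)).hom

lemma braiding_tensorμ (h : IsSymmetricBraiding C) (X₁ X₂ Y₁ Y₂ : C) :
    (β_ (X₁ ⊗ X₂) (Y₁ ⊗ Y₂)).hom ≫ tensorμ Y₁ Y₂ X₁ X₂ =
      tensorμ X₁ X₂ Y₁ Y₂ ≫ ((β_ X₁ Y₁).hom ⊗ₘ (β_ X₂ Y₂).hom) := by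
  have h1 : (β_ Y₂ X₁).hom = (β_ X₁ Y₂).inv := by
    rw [← cancel_epi (β_ X₁ Y₂).hom, h, Iso.hom_inv_id]
  simp [tensorμ, h1, MonoidalCategory.tensorHom_def]

lemma tensorμ_braiding (h : IsSymmetricBraiding C) (X₁ X₂ Y₁ Y₂ : C) :
    ((β_ X₁ X₂).hom ⊗ₘ (β_ Y₁ Y₂).hom) ≫ tensorμ X₂ X₁ Y₂ Y₁ =
      tensorμ X₁ X₂ Y₁ Y₂ ≫ (β_ (X₁ ⊗ Y₁) (X₂ ⊗ Y₂)).hom := by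
  have h1 : (β_ Y₁ X₂).hom = (β_ X₂ Y₁).inv := by
    rw [← cancel_epi (β_ X₂ Y₁).hom, h, Iso.hom_inv_id]
  simp [tensorμ, h1, MonoidalCategory.tensorHom_def]

lemma boxPairing_eq (h : IsSymmetricBraiding C) {Y₁ Y₂ X₁ X₂ : C} [ExactPairing X₁ Y₁]
    [ExactPairing X₂ Y₂] : boxPairing (ε_ X₁ Y₁) (ε_ X₂ Y₂) =
      (β_ Y₁ Y₂).hom ▷ (X₁ ⊗ X₂) ≫ ε_ (X₁ ⊗ X₂) (Y₂ ⊗ Y₁) := by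
  have h1 : (β_ Y₁ Y₂).hom = (β_ Y₂ Y₁).inv := by
    rw [← cancel_epi (β_ Y₂ Y₁).hom, h, Iso.hom_inv_id]
  have h2 : Y₂ ◁ ε_ X₁ Y₁ = (β_ Y₂ (Y₁ ⊗ X₁)).hom ≫ ε_ X₁ Y₁ ▷ Y₂ ≫ (β_ Y₂ (𝟙_ C)).inv := by
    rw [← BraidedCategory.braiding_naturality_right_assoc]; simp
  rw [ExactPairing.tensor_evaluation]
  have h3 : 𝟙 _ ⊗≫ Y₂ ◁ (ε_ X₁ Y₁ ▷ X₂) ⊗≫ ε_ X₂ Y₂ =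
      𝟙 ((Y₂ ⊗ Y₁) ⊗ (X₁ ⊗ X₂)) ⊗≫ (Y₂ ◁ ε_ X₁ Y₁) ▷ X₂ ⊗≫ ε_ X₂ Y₂ := by monoidal
  rw [h3, h2, boxPairing, h1]
  simp [tensorμ, monoidalComp, MonoidalCategory.tensorHom_def]

lemma isPerfect_box (h : IsSymmetricBraiding C) {Y₁ Y₂ X₁ X₂ : C} [ExactPairing X₁ Y₁]
    [ExactPairing X₂ Y₂] : IsPerfect (boxPairing (ε_ X₁ Y₁) (ε_ X₂ Y₂)) := by
  rw [boxPairing_eq h]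
  exact (isPerfect_comp_iff (isPerfect_evaluation _ _) _).2 inferInstance

/-- Product of non-singular forms: `b □ b'`. -/
def QForm.box (h : IsSymmetricBraiding C) {M N : C} (b : QForm M) (b' : QForm N) :
    QForm (M ⊗ N) where
  form := boxPairing b.form b'.form
  symm := by
    have h1 := b.symm
    have h2 := b'.symm
    unfold IsSymmetricForm at *
    unfold boxPairing
    rw [← Category.assoc, braiding_tensorμ h, Category.assoc, tensorHom_comp_tensorHom_assoc,
      h1, h2]
  nonsing := by
    have : IsIso (adj b.form) := b.nonsing
    have : IsIso (adj b'.form) := b'.nonsing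
    let P : ExactPairing M M := exactPairingCongrRight (asIso (adj b.form))
    let P' : ExactPairing N N := exactPairingCongrRight (asIso (adj b'.form))
    have e1 : ε_ M M = b.form := (eq_adj b.form).symm
    have e2 : ε_ N N = b'.form := (eq_adj b'.form).symm
    have := isPerfect_box h (Y₁ := M) (Y₂ := N) (X₁ := M) (X₂ := N)
    rw [e1, e2] at this
    exact (isNonsingular_iff _).2 this

/-- The tensor product `(M ⊗ M', b □ b')` of non-singular quadratic objects. -/
def QuadObj.tensor (h : IsSymmetricBraiding C) (Q Q' : QuadObj C) : QuadObj C where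
  obj := Q.obj ⊗ Q'.obj
  q := Q.q.box h Q'.q

lemma Isometric.refl (Q : QuadObj C) : Isometric Q Q := ⟨Iso.refl _, by simp⟩

lemma Isometric.symm {Q Q' : QuadObj C} : Isometric Q Q' → Isometric Q' Q := by
  rintro ⟨e, he⟩
  refine ⟨e.symm, ?_⟩
  rw [← he, tensorHom_comp_tensorHom_assoc]
  simp

lemma Isometric.trans {Q Q' Q'' : QuadObj C} : Isometric Q Q' → Isometric Q' Q'' →
    Isometric Q Q'' := by
  rintro ⟨e, he⟩ ⟨f, hf⟩
  refine ⟨e.trans f, ?_⟩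
  rw [← he, ← hf, tensorHom_comp_tensorHom_assoc]
  simp

lemma perp_congr {Q Q' R R' : QuadObj C} : Isometric Q Q' → Isometric R R' →
    Isometric (perp Q R) (perp Q' R') := by
  rintro ⟨e, he⟩ ⟨f, hf⟩
  refine ⟨biprod.mapIso e f, ?_⟩
  simp only [perp, biprod.mapIso_hom, Preadditive.comp_add, tensorHom_comp_tensorHom_assoc,
    biprod.map_fst, biprod.map_snd]
  rw [← he, ← hf]
  simp

lemma tensor_congr_left (h : IsSymmetricBraiding C) {Q Q' : QuadObj C} (R : QuadObj C) :
    Isometric Q Q' → Isometric (Q.tensor h R) (Q'.tensor h R) := by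
  rintro ⟨e, he⟩
  refine ⟨whiskerRightIso e R.obj, ?_⟩
  simp only [QuadObj.tensor, QForm.box, boxPairing, whiskerRightIso_hom]
  rw [← tensorHom_id, ← Category.assoc, tensorμ_natural, Category.assoc,
    tensorHom_comp_tensorHom_assoc, he]
  simp

lemma tensor_comm (h : IsSymmetricBraiding C) (Q R : QuadObj C) :
    Isometric (Q.tensor h R) (R.tensor h Q) := by
  refine ⟨β_ Q.obj R.obj, ?_⟩
  simp only [QuadObj.tensor, QForm.box, boxPairing]
  rw [← Category.assoc, tensorμ_braiding h, Category.assoc,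
    ← BraidedCategory.braiding_naturality_assoc]
  simp [← unitors_equal]

lemma tensor_distrib (h : IsSymmetricBraiding C) (Q Q' R : QuadObj C) :
    Isometric ((perp Q Q').tensor h R) (perp (Q.tensor h R) (Q'.tensor h R)) := by
  refine ⟨rightDistrib Q.obj Q'.obj R.obj, ?_⟩
  simp only [QuadObj.tensor, QForm.box, boxPairing, perp, rightDistrib, Preadditive.comp_add,
    tensorHom_comp_tensorHom_assoc, biprod.lift_fst, biprod.lift_snd, ← tensorHom_id]
  rw [← Category.assoc, tensorμ_natural, ← Category.assoc _ (tensorμ _ _ _ _), tensorμ_natural,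
    MonoidalPreadditive.add_tensor, Preadditive.add_comp, Preadditive.comp_add]
  simp only [Category.assoc, tensorHom_comp_tensorHom_assoc]
  simp

/-- A quadratic object on `A ⊞ B` whose form is off-diagonal is hyperbolic. -/
lemma isometric_hyp {A B : C} (hA : IsWeaklySymmetric A) {g : B ⊗ A ⟶ 𝟙_ C} (hg : IsPerfect g)
    (Q : QuadObj C) (e : Q.obj ≅ A ⊞ B)
    (he : Q.q.form = (e.hom ⊗ₘ e.hom) ≫ ((biprod.snd ⊗ₘ biprod.fst) ≫ g +
      (biprod.fst ⊗ₘ biprod.snd) ≫ (β_ A B).hom ≫ g)) :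
    Isometric Q (hyp A hA) := by
  obtain ⟨f, hf⟩ := (isPerfect_evaluation A Aᘁ B).2 g
  simp only at hf
  have : IsIso f := by
    rw [← isPerfect_comp_iff (isPerfect_evaluation A Aᘁ), hf]; exact hg
  refine ⟨e.trans (biprod.mapIso (Iso.refl A) (asIso f)), ?_⟩
  rw [he]
  simp only [hyp, hypForm, Iso.trans_hom, biprod.mapIso_hom, Iso.refl_hom, asIso_hom,
    ← tensorHom_comp_tensorHom, Category.assoc]
  congr 1
  simp only [Preadditive.comp_add, tensorHom_comp_tensorHom_assoc, biprod.map_fst, biprod.map_snd]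
  rw [← hf, ← tensorHom_id]
  simp only [← BraidedCategory.braiding_naturality_assoc, tensorHom_comp_tensorHom_assoc]

lemma IsSymmetricBraiding.weaklySymmetric (h : IsSymmetricBraiding C) (M : C) :
    IsWeaklySymmetric M := by
  unfold IsWeaklySymmetric
  rw [← Category.assoc, h, Category.id_comp]

lemma hyp_tensor (h : IsSymmetricBraiding C) (M : C) (hM : IsWeaklySymmetric M) (R : QuadObj C) :
    Isometric ((hyp M hM).tensor h R) (hyp (M ⊗ R.obj) (h.weaklySymmetric _)) := by
  have hg : IsPerfect (boxPairing (ε_ M Mᘁ) R.q.form) := by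
    have : IsIso (adj R.q.form) := R.q.nonsing
    let P : ExactPairing R.obj R.obj := exactPairingCongrRight (asIso (adj R.q.form))
    have e1 : ε_ R.obj R.obj = R.q.form := (eq_adj R.q.form).symm
    have := isPerfect_box h (Y₁ := Mᘁ) (Y₂ := R.obj) (X₁ := M) (X₂ := R.obj)
    rwa [e1] at this
  refine isometric_hyp _ hg _ (rightDistrib M Mᘁ R.obj) ?_
  have hs : (β_ R.obj R.obj).hom ≫ R.q.form = R.q.form := R.q.symm
  simp only [QuadObj.tensor, QForm.box, boxPairing, hyp, hypForm, rightDistrib,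
    Preadditive.comp_add, tensorHom_comp_tensorHom_assoc, biprod.lift_fst, biprod.lift_snd,
    ← tensorHom_id]
  rw [reassoc_of% (braiding_tensorμ h M R.obj Mᘁ R.obj), tensorμ_natural_assoc,
    tensorμ_natural_assoc, MonoidalPreadditive.add_tensor, Preadditive.add_comp,
    Preadditive.comp_add]
  simp only [tensorHom_comp_tensorHom_assoc]
  simp [hs]

/-- The product of `K₀(Q)` induced by the tensor product of quadratic objects. -/
noncomputable def K0Quad.mulHom (h : IsSymmetricBraiding C) :
    K0Quad C →+ K0Quad C →+ K0Quad C :=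
  KZero.mul (QuadObj.tensor h)
    (fun _ _ b => tensor_congr_left h b)
    (fun a b b' e => ((tensor_comm h a b).trans (tensor_congr_left h a e)).trans
      (tensor_comm h b' a))
    (fun a a' b => tensor_distrib h a a' b)
    (fun a b b' => ((tensor_comm h a _).trans (tensor_distrib h b b' a)).trans
      (perp_congr (tensor_comm h b a) (tensor_comm h b' a)))

lemma K0Quad.mulHom_mem_left (h : IsSymmetricBraiding C) {x : K0Quad C} (hx : x ∈ hypSubgroup C)
    (y : K0Quad C) : K0Quad.mulHom h x y ∈ hypSubgroup C := by
  revert y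
  refine AddSubgroup.closure_induction (p := fun x _ => ∀ y, K0Quad.mulHom h x y ∈ hypSubgroup C)
    ?_ ?_ ?_ ?_ hx
  · rintro _ ⟨M, hM, rfl⟩ y
    obtain ⟨z, rfl⟩ := QuotientAddGroup.mk'_surjective _ y
    induction z using FreeAbelianGroup.induction_on with
    | zero => rw [map_zero, map_zero]; exact zero_mem _
    | of R =>
      change K0Quad.mulHom h (KZero.cls _ _ _) (KZero.cls Isometric perp R) ∈ _
      rw [K0Quad.mulHom, KZero.mul_cls, KZero.cls_eq (hyp_tensor h M hM R)]
      exact AddSubgroup.subset_closure ⟨_, _, rfl⟩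
    | neg R hR => rw [map_neg, map_neg]; exact neg_mem hR
    | add z z' hz hz' => rw [map_add, map_add]; exact add_mem hz hz'
  · intro y; rw [map_zero]; exact zero_mem _
  · intro a b _ _ ha hb y; rw [map_add]; exact add_mem (ha y) (hb y)
  · intro a _ ha y; rw [map_neg]; exact neg_mem (ha y)

lemma K0Quad.mulHom_comm (h : IsSymmetricBraiding C) (x y : K0Quad C) :
    K0Quad.mulHom h x y = K0Quad.mulHom h y x := by
  have : K0Quad.mulHom h = (K0Quad.mulHom h).flip := KZero.hom_ext fun Q => KZero.hom_ext fun R => by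
    rw [AddMonoidHom.flip_apply, K0Quad.mulHom, KZero.mul_cls, KZero.mul_cls]
    exact KZero.cls_eq (tensor_comm h Q R)
  exact DFunLike.congr_fun (DFunLike.congr_fun this x) y

/-- The (biadditive) product of the Witt group of a category with symmetric braiding. -/
noncomputable def Witt.mulHom (h : IsSymmetricBraiding C) : Witt C →+ Witt C →+ Witt C :=
  QuotientAddGroup.lift (hypSubgroup C)
    (AddMonoidHom.mk' (fun x => QuotientAddGroup.map (hypSubgroup C) (hypSubgroup C)
      (K0Quad.mulHom h x) (fun y hy => by
        rw [AddSubgroup.mem_comap, K0Quad.mulHom_comm]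
        exact K0Quad.mulHom_mem_left h hy x))
      (fun x x' => QuotientAddGroup.addMonoidHom_ext _ (by
        ext y
        simp)))
    (fun x hx => QuotientAddGroup.addMonoidHom_ext _ (by
      apply AddMonoidHom.ext
      intro y
      exact (QuotientAddGroup.eq_zero_iff _).2 (K0Quad.mulHom_mem_left h hx y)))

/-- The product of classes is the class of `(M ⊗ M', b □ b')`. -/
lemma Witt.mulHom_cls (h : IsSymmetricBraiding C) (Q R : QuadObj C) :
    Witt.mulHom h (Witt.cls Q) (Witt.cls R) = Witt.cls (Q.tensor h R) := by
  change QuotientAddGroup.mk' (hypSubgroup C) (K0Quad.mulHom h (KZero.cls _ _ Q)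
    (KZero.cls _ _ R)) = _
  rw [K0Quad.mulHom, KZero.mul_cls]
  rfl

end Quadratic

/-! ### Braided fusion categories -/

section Fusion

/-- A rigid `k`-linear monoidal abelian category is a fusion category if it is semisimple with
finitely many isomorphism classes of simple objects, has finite-dimensional Hom-spaces, and its
unit object is simple. -/
class IsFusion (k : Type w) [Field k] (C : Type u) [Category.{v} C] [Abelian C] [Linear k C]
    [MonoidalCategory C] [MonoidalPreadditive C] [MonoidalLinear k C] [RightRigidCategory C] :
    Prop where
  finite_hom : ∀ X Y : C, Module.Finite k (X ⟶ Y)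
  semisimple : ∀ M : C, ∃ (n : ℕ) (f : Fin n → C),
    (∀ i, Simple (f i)) ∧ Nonempty (M ≅ ⨁ f)
  finite_simple : ∃ (n : ℕ) (f : Fin n → C), ∀ X : C, Simple X → ∃ i, Nonempty (X ≅ f i)
  simple_unit : Simple (𝟙_ C)

variable (C : Type u) [Category.{v} C] [Abelian C] [MonoidalCategory C]

/-- Representatives `X i` of the isomorphism classes of simple objects, together with the
index `i* = star i` of the dual of `X i` and a choice of dual pairs `(X i, X i*)`. -/
structure SimpleReps (ι : Type w) where
  /-- the representatives -/
  X : ι → C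
  simple : ∀ i, Simple (X i)
  eq_of_iso : ∀ i j, Nonempty (X i ≅ X j) → i = j
  exists_iso : ∀ Y : C, Simple Y → ∃ i, Nonempty (Y ≅ X i)
  /-- `i ↦ i*` -/
  star : ι → ι
  /-- the evaluation `X i* ⊗ X i ⟶ I` and coevaluation `I ⟶ X i ⊗ X i*` -/
  pairing : ∀ i, ExactPairing (X i) (X (star i))

namespace SimpleReps

variable {C} {ι : Type w} (S : SimpleReps C ι)

/-- The evaluation `ev_i : X i* ⊗ X i ⟶ I`. -/
def ev (i : ι) : S.X (S.star i) ⊗ S.X i ⟶ 𝟙_ C :=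
  (S.pairing i).evaluation'

variable [BraidedCategory C]

lemma star_star (i : ι) : S.star (S.star i) = i :=
  (S.eq_of_iso _ _ ⟨rightDualIso (S.pairing (S.star i))
    (@BraidedCategory.exactPairing_swap C _ _ _ (S.X i) (S.X (S.star i)) (S.pairing i))⟩)

/-- `ev_i ∘ c_{X i, X i*} = d i • ev_{i*}` for all `i`, where `X i** = X i`. -/
def IsSign {k : Type*} [Field k] [Linear k C] (d : ι → k) : Prop :=
  ∀ i, (β_ (S.X i) (S.X (S.star i))).hom ≫ S.ev i =
    d i • (eqToHom (congrArg S.X (S.star_star i).symm) ▷ S.X (S.star i) ≫ S.ev (S.star i))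

end SimpleReps

end Fusion

end BraidedWitt

namespace BraidedWitt

universe v u w

/-! ### Perfect pairings: change of variables and orthogonal summands. -/

section Splitting

variable {C : Type u} [Category.{v} C] [MonoidalCategory C]

/-! By Schur's lemma a pairing of two simple objects is either zero or perfect, and any two perfect
ones are proportional. Hence the scalars `d i` exist, and `X i` carries a non-singular symmetric
form exactly when `i = i*` and `d i = 1`. Square roots in `k` make all such forms on `X i`
isometric.

These simple classes generate the Witt group (`cls_mem_closure`). A non-singular subobject splits
off as an orthogonal summand (`exists_isometric_perp`). If the form of `M` pulls back to a nonzero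
form along some morphism from a simple object, that simple object splits off. Otherwise every simple
subobject is isotropic, and one of them together with a dual partner spans a hyperbolic summand,
whose class is zero. Induction on the length of `M` finishes the argument. As `-1` is a square and
`2` is invertible, `Q ⊥ Q` is hyperbolic (`Witt.cls_add_self`), so the group is a `ℤ/2`-vector
space.

Independence is a count: a self-dual simple object occurs equally often in `M` and in its dual
(`mult_dual`), so multiplicities modulo two vanish on hyperbolic objects and give coordinates on the
Witt group (`wittParity`). They depend only on the underlying object, so the same coordinates exist
on `K₀ ⊗ ℤ/2` (`tensorParity`). The product formula then holds because the product of `[X i]` and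
`[X j]` is carried by `X i ⊗ X j`. -/

lemma IsPerfect.tensorHom_comp {Y Y' X X' : C} {e : Y ⊗ X ⟶ 𝟙_ C} (he : IsPerfect e)
    (g : Y' ⟶ Y) (h : X' ⟶ X) [IsIso g] [IsIso h] : IsPerfect ((g ⊗ₘ h) ≫ e) := by
  intro Z
  have : (fun f : Z ⟶ Y' => f ▷ X' ≫ (g ⊗ₘ h) ≫ e) =
      (fun u : Z ⊗ X ⟶ 𝟙_ C => Z ◁ h ≫ u) ∘ (fun f : Z ⟶ Y => f ▷ X ≫ e) ∘
        (fun f : Z ⟶ Y' => f ≫ g) := by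
    funext f
    simp [tensorHom_def', whisker_exchange_assoc]
  rw [this]
  exact ((asIso (Z ◁ h)).homFromEquiv.symm.bijective.comp (he Z)).comp
    ((asIso g).homToEquiv (Z := Z)).bijective

variable [Preadditive C] [HasBinaryBiproducts C] [MonoidalPreadditive C]

/-- Test morphisms with zero first component give injectivity. For surjectivity, a form on `Z ⊗ X'`
is extended by zero, represented, and restricted again. This makes the form on an orthogonal
complement non-singular. -/
lemma isPerfect_of_biprod_snd {Y Y' X X' : C} {e : Y ⊗ X ⟶ 𝟙_ C} {e' : Y' ⊗ X' ⟶ 𝟙_ C}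
    (h : IsPerfect (((biprod.fst : Y ⊞ Y' ⟶ Y) ⊗ₘ (biprod.fst : X ⊞ X' ⟶ X)) ≫ e +
      (biprod.snd ⊗ₘ biprod.snd) ≫ e')) : IsPerfect e' := by
  have key : ∀ {Z : C} (f : Z ⟶ Y ⊞ Y'), f ▷ (X ⊞ X') ≫
      (((biprod.fst : Y ⊞ Y' ⟶ Y) ⊗ₘ (biprod.fst : X ⊞ X' ⟶ X)) ≫ e +
      (biprod.snd ⊗ₘ biprod.snd) ≫ e') =
      Z ◁ biprod.fst ≫ (f ≫ biprod.fst) ▷ X ≫ e + Z ◁ biprod.snd ≫ (f ≫ biprod.snd) ▷ X' ≫ e' := by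
    intro Z f
    simp only [Preadditive.comp_add, ← id_tensorHom, ← tensorHom_id,
      tensorHom_comp_tensorHom_assoc, Category.id_comp, Category.comp_id]
  have z : ∀ {A B D : C}, (0 : A ⟶ B) ▷ D = 0 := MonoidalPreadditive.zero_whiskerRight
  intro Z
  constructor
  · intro f g hfg
    have hfg : f ▷ X' ≫ e' = g ▷ X' ≫ e' := hfg
    have := (h Z).1 (a₁ := biprod.lift 0 f) (a₂ := biprod.lift 0 g) (by
      simp only [key, biprod.lift_fst, biprod.lift_snd, hfg])
    simpa using congrArg (· ≫ biprod.snd) this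
  · intro g
    obtain ⟨f, hf⟩ := (h Z).2 (Z ◁ biprod.snd ≫ g)
    simp only [key] at hf
    refine ⟨f ≫ biprod.snd, ?_⟩
    have := congrArg (Z ◁ biprod.inr ≫ ·) hf
    simpa [← whiskerLeft_comp_assoc] using this

end Splitting

set_option linter.unusedSectionVars false

/-! ### Weak symmetry of objects that carry forms. -/

section Forms

variable {C : Type u} [Category.{v} C] [MonoidalCategory C] [BraidedCategory C]
  [RightRigidCategory C]

lemma QForm.perfect {M : C} (q : QForm M) : IsPerfect q.form := (isNonsingular_iff _).1 q.nonsing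

/-- Weak symmetry does not depend on the chosen dual: `g` differs from the evaluation by an
isomorphism `B ⟶ Aᘁ`, and the double braiding is natural. -/
lemma weaklySymmetric_of_perfect {A B : C} {g : B ⊗ A ⟶ 𝟙_ C} (hg : IsPerfect g)
    (h : (β_ B A).hom ≫ (β_ A B).hom ≫ g = g) : IsWeaklySymmetric A := by
  obtain ⟨f, hf⟩ := (isPerfect_evaluation A Aᘁ B).2 g
  simp only at hf
  have : IsIso f := by
    rw [← isPerfect_comp_iff (isPerfect_evaluation A Aᘁ), hf]; exact hg
  unfold IsWeaklySymmetric
  rw [← cancel_epi (f ▷ A), BraidedCategory.braiding_naturality_left_assoc,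
    BraidedCategory.braiding_naturality_right_assoc, hf, h]

lemma QForm.weaklySymmetric {M : C} (q : QForm M) : IsWeaklySymmetric M :=
  weaklySymmetric_of_perfect q.perfect (by rw [q.symm, q.symm])

end Forms

/-! ### Orthogonal splitting and 2-torsion in the Witt group. -/

section Abelian

variable {C : Type u} [Category.{v} C] [Abelian C] [MonoidalCategory C] [MonoidalPreadditive C]
  [BraidedCategory C]

/-- A retraction with complement `kernel p`. -/
noncomputable def retractIso {N M : C} (f : N ⟶ M) (p : M ⟶ N) (h : f ≫ p = 𝟙 N) :
    M ≅ N ⊞ kernel p where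
  hom := biprod.lift p (kernel.lift p (𝟙 M - p ≫ f) (by simp [Preadditive.sub_comp, h]))
  inv := biprod.desc f (kernel.ι p)
  hom_inv_id := by simp [biprod.lift_desc]
  inv_hom_id := by
    refine biprod.hom_ext' _ _ (biprod.hom_ext _ _ ?_ ?_) (biprod.hom_ext _ _ ?_ ?_)
    · simp [h]
    · rw [← cancel_mono (kernel.ι p)]
      simp [reassoc_of% h, Preadditive.comp_sub]
    · simp
    · rw [← cancel_mono (kernel.ι p)]
      simp [Preadditive.comp_sub]

variable [RightRigidCategory C]

/-- A nonsingular subobject of a quadratic object splits off as an orthogonal summand. -/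
lemma exists_isometric_perp (Q : QuadObj C) {N : C} (q : QForm N) (f : N ⟶ Q.obj)
    (hf : (f ⊗ₘ f) ≫ Q.q.form = q.form) : ∃ K : QuadObj C, Isometric Q (perp ⟨N, q⟩ K) := by
  -- `p` is the adjoint of `f`: the form of `Q` against `f` equals `q` against `p`. It will be the
  -- orthogonal projection onto `N`.
  obtain ⟨p, hp⟩ := (q.perfect Q.obj).2 (Q.obj ◁ f ≫ Q.q.form)
  simp only at hp
  have hfp : f ≫ p = 𝟙 N := by
    apply (q.perfect N).1
    simp only [comp_whiskerRight, Category.assoc, hp, id_whiskerRight, Category.id_comp]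
    rw [← hf, tensorHom_def_assoc]
  let e := retractIso f p hfp
  let k := kernel.ι p
  -- By adjointness, `kernel p` is the orthogonal complement of `N`; symmetry handles the other
  -- order. So the form is block diagonal along `retractIso`.
  have hkf : (k ⊗ₘ f) ≫ Q.q.form = 0 := by
    rw [tensorHom_def_assoc, ← hp, ← comp_whiskerRight_assoc, kernel.condition,
      MonoidalPreadditive.zero_whiskerRight, zero_comp]
  have hfk : (f ⊗ₘ k) ≫ Q.q.form = 0 := by
    rw [← Q.q.symm, BraidedCategory.braiding_naturality_assoc, hkf, comp_zero]
  have hform : (e.inv ⊗ₘ e.inv) ≫ Q.q.form = (biprod.fst ⊗ₘ biprod.fst) ≫ q.form +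
      (biprod.snd ⊗ₘ biprod.snd) ≫ (k ⊗ₘ k) ≫ Q.q.form := by
    have : e.inv = biprod.fst ≫ f + biprod.snd ≫ k := by
      ext <;> simp [e, k, retractIso]
    rw [this]
    simp only [MonoidalPreadditive.add_tensor, MonoidalPreadditive.tensor_add,
      Preadditive.add_comp, ← tensorHom_comp_tensorHom, Category.assoc, hf, hkf, hfk, comp_zero,
      add_zero, zero_add]
  refine ⟨⟨kernel p, (k ⊗ₘ k) ≫ Q.q.form, ?_, ?_⟩, e, ?_⟩
  · unfold IsSymmetricForm
    rw [← BraidedCategory.braiding_naturality_assoc, Q.q.symm]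
  · rw [isNonsingular_iff]
    refine isPerfect_of_biprod_snd (e := q.form) ?_
    rw [← hform]
    exact Q.q.perfect.tensorHom_comp _ _
  · change (e.hom ⊗ₘ e.hom) ≫ ((biprod.fst ⊗ₘ biprod.fst) ≫ q.form +
      (biprod.snd ⊗ₘ biprod.snd) ≫ (k ⊗ₘ k) ≫ Q.q.form) = _
    rw [← hform, tensorHom_comp_tensorHom_assoc]
    simp

lemma Witt.cls_eq {Q Q' : QuadObj C} (h : Isometric Q Q') : Witt.cls Q = Witt.cls Q' := by
  rw [Witt.cls, KZero.cls_eq h, Witt.cls]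

lemma Witt.cls_perp (Q Q' : QuadObj C) : Witt.cls (perp Q Q') = Witt.cls Q + Witt.cls Q' := by
  rw [Witt.cls, KZero.cls_prod, map_add, Witt.cls, Witt.cls]

lemma Witt.cls_hyp {M : C} (hM : IsWeaklySymmetric M) : Witt.cls (hyp M hM) = 0 :=
  (QuotientAddGroup.eq_zero_iff _).2 (AddSubgroup.subset_closure ⟨M, hM, rfl⟩)

/-- A zero object satisfies `Q ⊥ Q ≅ Q`, so its class equals its own double. -/
lemma Witt.cls_eq_zero_of_isZero (Q : QuadObj C) (h : IsZero Q.obj) : Witt.cls Q = 0 := by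
  have : Isometric (perp Q Q) Q := by
    have h2 : IsZero (Q.obj ⊞ Q.obj) := (biprod_isZero_iff _ _).2 ⟨h, h⟩
    refine ⟨h2.iso h, ?_⟩
    have : IsZero ((Q.obj ⊞ Q.obj) ⊗ (Q.obj ⊞ Q.obj)) := by
      rw [IsZero.iff_id_eq_zero] at h2 ⊢
      rw [← id_whiskerRight, h2, MonoidalPreadditive.zero_whiskerRight]
    exact this.eq_of_src _ _
  have := Witt.cls_eq this
  rwa [Witt.cls_perp, add_eq_left] at this

lemma Witt.hom_ext {G : Type*} [AddCommGroup G] {f g : Witt C →+ G}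
    (h : ∀ Q, f (Witt.cls Q) = g (Witt.cls Q)) : f = g :=
  QuotientAddGroup.addMonoidHom_ext _ (KZero.hom_ext h)

variable {k : Type*} [Field k] [Linear k C] [MonoidalLinear k C]

lemma smul_tensorHom {A B A' B' : C} (r : k) (f : A ⟶ B) (g : A' ⟶ B') :
    (r • f) ⊗ₘ g = r • (f ⊗ₘ g) := by
  simp [MonoidalCategory.tensorHom_def]

lemma tensorHom_smul {A B A' B' : C} (r : k) (f : A ⟶ B) (g : A' ⟶ B') :
    f ⊗ₘ (r • g) = r • (f ⊗ₘ g) := by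
  simp [MonoidalCategory.tensorHom_def]

variable [IsAlgClosed k] [CharZero k]

/-- This is `x² + y² = (x + ay)(x - ay)`, symmetrised: `b(x, y)` and `b(y, x)` may differ, but
adding both orders cancels the cross terms, and the factor `1/2` corrects the doubling. -/
lemma sum_squares_eq_hyperbolic {M N : C} (b : M ⊗ M ⟶ 𝟙_ C) (x y : N ⟶ M) {a : k}
    (ha : a ^ 2 = -1) : (x ⊗ₘ x) ≫ b + (y ⊗ₘ y) ≫ b =
      (((1 / 2 : k) • (x + (-a) • y)) ⊗ₘ (x + a • y)) ≫ b +
      ((x + a • y) ⊗ₘ ((1 / 2 : k) • (x + (-a) • y))) ≫ b := by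
  simp only [MonoidalPreadditive.add_tensor, MonoidalPreadditive.tensor_add, smul_add,
    smul_tensorHom, tensorHom_smul, Preadditive.add_comp, Linear.smul_comp]
  match_scalars
  · ring
  · linear_combination ha
  · ring
  · ring

variable (k) in
include k in
/-- Over a field containing `√-1` and `1/2`, the object `Q ⊥ Q` is hyperbolic. -/
lemma Witt.cls_add_self (Q : QuadObj C) : Witt.cls Q + Witt.cls Q = 0 := by
  rw [← Witt.cls_perp, ← Witt.cls_hyp Q.q.weaklySymmetric]
  apply Witt.cls_eq
  obtain ⟨a, ha⟩ := IsAlgClosed.exists_pow_nat_eq (-1 : k) (n := 2) (by norm_num)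
  let x : Q.obj ⊞ Q.obj ⟶ Q.obj := biprod.fst
  let y : Q.obj ⊞ Q.obj ⟶ Q.obj := biprod.snd
  -- The new coordinates are `u = x + ay` and `v = (x - ay)/2`. Since `1/a = -a`, they invert to `x
  -- = u/2 + v` and `y = a(v - u/2)`; in `inv` the projections named `x`, `y` play the roles of `u`,
  -- `v`.
  let e : Q.obj ⊞ Q.obj ≅ Q.obj ⊞ Q.obj :=
    { hom := biprod.lift (x + a • y) ((1 / 2 : k) • (x - a • y))
      inv := biprod.lift ((1 / 2 : k) • x + y) (a • (y - (1 / 2 : k) • x))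
      hom_inv_id := by
        apply biprod.hom_ext <;>
        simp only [x, y, Category.assoc, biprod.lift_fst, biprod.lift_snd, Preadditive.comp_add,
          Preadditive.comp_sub, Linear.comp_smul, Category.id_comp]
        · module
        · match_scalars
          · ring
          · linear_combination -ha
      inv_hom_id := by
        apply biprod.hom_ext <;>
        simp only [x, y, Category.assoc, biprod.lift_fst, biprod.lift_snd, Preadditive.comp_add,
          Preadditive.comp_sub, Linear.comp_smul, Category.id_comp]
        · match_scalars
          · linear_combination (-1 / 2) * ha
          · linear_combination ha
        · match_scalars
          · linear_combination (1 / 4) * ha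
          · linear_combination (-1 / 2) * ha }
  -- The form itself serves as the perfect pairing between the two isotropic copies of `Q.obj`.
  refine isometric_hyp _ Q.q.perfect _ e ?_
  rw [Q.q.symm]
  have e1 : e.hom ≫ biprod.fst = x + a • y := biprod.lift_fst _ _
  have e2 : e.hom ≫ biprod.snd = (1 / 2 : k) • (x + (-a) • y) := by
    rw [neg_smul, ← sub_eq_add_neg]; exact biprod.lift_snd _ _
  rw [Preadditive.comp_add]
  erw [tensorHom_comp_tensorHom_assoc, tensorHom_comp_tensorHom_assoc, e1, e2]
  exact sum_squares_eq_hyperbolic _ x y ha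

end Abelian

end BraidedWitt

namespace BraidedWitt

universe v u w

set_option linter.unusedSectionVars false

/-! ### Multiplicities, and generation by simple objects. -/

section Fusion

variable (k : Type*) [Field k] {C : Type u} [Category.{v} C] [Abelian C]
  [Linear k C] [MonoidalCategory C] [MonoidalPreadditive C] [MonoidalLinear k C]
  [RightRigidCategory C] [IsFusion k C]

/-- Split off the first summand of a finite biproduct. -/
noncomputable def biproductFinSucc {n : ℕ} (f : Fin (n + 1) → C) :
    ⨁ f ≅ f 0 ⊞ ⨁ (fun j : Fin n => f j.succ) where
  hom := biprod.lift (biproduct.π f 0) (biproduct.lift fun j => biproduct.π f j.succ)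
  inv := biprod.desc (biproduct.ι f 0) (biproduct.desc fun j => biproduct.ι f j.succ)
  hom_inv_id := by
    rw [biprod.lift_desc, biproduct.lift_desc, ← biproduct.total, Fin.sum_univ_succ]
  inv_hom_id := by
    refine biprod.hom_ext' _ _ (biprod.hom_ext _ _ ?_ ?_) (biprod.hom_ext _ _ ?_ ?_)
    · simp
    · refine biproduct.hom_ext _ _ fun j => ?_
      simp [biproduct.ι_π_ne _ (Fin.succ_ne_zero j).symm]
    · refine biproduct.hom_ext' _ _ fun j => ?_
      simp [biproduct.ι_π_ne _ (Fin.succ_ne_zero j)]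
    · refine biproduct.hom_ext' _ _ fun j => biproduct.hom_ext _ _ fun l => ?_
      by_cases h : j = l
      · subst h; simp
      · simp [biproduct.ι_π_ne _ h, biproduct.ι_π_ne f (fun h' => h (Fin.succ_injective _ h'))]

include k in
/-- A property of objects that is stable under isomorphisms and direct sums and holds for zero
and simple objects holds for every object of a fusion category. -/
lemma IsFusion.induction {P : C → Prop} (iso : ∀ X Y : C, (X ≅ Y) → P X → P Y)
    (zero : ∀ X : C, IsZero X → P X) (simple : ∀ X : C, Simple X → P X)
    (biprod : ∀ X Y : C, P X → P Y → P (X ⊞ Y)) (M : C) : P M := by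
  obtain ⟨n, f, hf, ⟨e⟩⟩ := IsFusion.semisimple (k := k) M
  refine iso _ _ e.symm ?_
  clear e
  induction n with
  | zero =>
    refine zero _ ((IsZero.iff_id_eq_zero _).2 (biproduct.hom_ext _ _ fun j => j.elim0))
  | succ n ih =>
    exact iso _ _ (biproductFinSucc f).symm
      (biprod _ _ (simple _ (hf 0)) (ih _ fun j => hf j.succ))

/-- `Hom(Z, Y) ≃ Hom(Z ⊗ X, I)` for a perfect pairing `Y ⊗ X ⟶ I`. -/
noncomputable def IsPerfect.homEquiv {Y X : C} {e : Y ⊗ X ⟶ 𝟙_ C} (he : IsPerfect e) (Z : C) :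
    (Z ⟶ Y) ≃ₗ[k] (Z ⊗ X ⟶ 𝟙_ C) :=
  LinearEquiv.ofBijective
    { toFun := fun f => f ▷ X ≫ e
      map_add' := fun f g => by
        rw [MonoidalPreadditive.add_whiskerRight, Preadditive.add_comp]
      map_smul' := fun r f => by
        rw [MonoidalLinear.smul_whiskerRight, Linear.smul_comp]; rfl } (he Z)

/-- `Hom(X, A ⊕ B) ≃ Hom(X, A) × Hom(X, B)`. -/
noncomputable def homBiprodEquiv (X A B : C) :
    (X ⟶ A ⊞ B) ≃ₗ[k] (X ⟶ A) × (X ⟶ B) where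
  toFun f := (f ≫ biprod.fst, f ≫ biprod.snd)
  map_add' f g := by simp
  map_smul' r f := by simp
  invFun f := biprod.lift f.1 f.2
  left_inv f := by apply biprod.hom_ext <;> simp
  right_inv f := by simp

/-- `Hom(A ⊕ B, X) ≃ Hom(A, X) × Hom(B, X)`. -/
noncomputable def biprodHomEquiv (X A B : C) :
    (A ⊞ B ⟶ X) ≃ₗ[k] (A ⟶ X) × (B ⟶ X) where
  toFun f := (biprod.inl ≫ f, biprod.inr ≫ f)
  map_add' f g := by simp
  map_smul' r f := by simp
  invFun f := biprod.desc f.1 f.2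
  left_inv f := by apply biprod.hom_ext' <;> simp
  right_inv f := by simp

lemma finrank_hom_biprod (X A B : C) : Module.finrank k (X ⟶ A ⊞ B) =
    Module.finrank k (X ⟶ A) + Module.finrank k (X ⟶ B) := by
  have := IsFusion.finite_hom (k := k) (C := C)
  rw [(homBiprodEquiv k X A B).finrank_eq, Module.finrank_prod]

lemma finrank_biprod_hom (X A B : C) : Module.finrank k (A ⊞ B ⟶ X) =
    Module.finrank k (A ⟶ X) + Module.finrank k (B ⟶ X) := by
  have := IsFusion.finite_hom (k := k) (C := C)
  rw [(biprodHomEquiv k X A B).finrank_eq, Module.finrank_prod]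

-- Both sides are additive in `M`, and for simple `M` Schur's lemma makes each 1 or 0 according to
-- whether `M ≅ X`.
open scoped Classical in
lemma finrank_hom_comm [IsAlgClosed k] (X : C) [Simple X] (M : C) :
    Module.finrank k (M ⟶ X) = Module.finrank k (X ⟶ M) := by
  have := IsFusion.finite_hom (k := k) (C := C)
  refine IsFusion.induction k (P := fun M => Module.finrank k (M ⟶ X) = Module.finrank k (X ⟶ M))
    ?_ ?_ ?_ ?_ M
  · intro A B e h
    rw [← (Linear.homCongr k e (Iso.refl X)).finrank_eq,
      ← (Linear.homCongr k (Iso.refl X) e).finrank_eq, h]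
  · intro A hA
    have : Subsingleton (A ⟶ X) := ⟨hA.eq_of_src⟩
    have : Subsingleton (X ⟶ A) := ⟨hA.eq_of_tgt⟩
    rw [Module.finrank_zero_of_subsingleton, Module.finrank_zero_of_subsingleton]
  · intro A hA
    rw [finrank_hom_simple_simple, finrank_hom_simple_simple]
    exact if_congr ⟨fun ⟨e⟩ => ⟨e.symm⟩, fun ⟨e⟩ => ⟨e.symm⟩⟩ rfl rfl
  · intro A B hA hB
    rw [finrank_hom_biprod, finrank_biprod_hom, hA, hB]

/-- `[X ⊕ Y] = [X] + [Y]`. -/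
lemma K0.cls_biprod (X Y : C) : K0.cls (X ⊞ Y) = K0.cls X + K0.cls Y := KZero.cls_prod X Y

lemma K0.cls_eq_zero_of_isZero {X : C} (h : IsZero X) : K0.cls X = 0 := by
  have := K0.cls_eq (((biprod_isZero_iff X X).2 ⟨h, h⟩).iso h)
  rwa [K0.cls_biprod, add_eq_left] at this

namespace SimpleReps

variable {ι : Type w} (S : SimpleReps C ι)

attribute [local instance] SimpleReps.simple

include k in
lemma finite_index (S : SimpleReps C ι) : Finite ι := by
  obtain ⟨n, f, hf⟩ := IsFusion.finite_simple (k := k) (C := C)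
  choose g hg using fun i => hf (S.X i) (S.simple i)
  refine Finite.of_injective g fun i j h => S.eq_of_iso i j ?_
  obtain ⟨a⟩ := hg i
  obtain ⟨b⟩ := hg j
  rw [← h] at b
  exact ⟨a.trans b.symm⟩

/-- The multiplicity of the simple object `X i` in `M`. -/
noncomputable def mult (i : ι) (M : C) : ℕ := Module.finrank k (S.X i ⟶ M)

omit [IsFusion k C] in
lemma mult_congr (i : ι) {M N : C} (e : M ≅ N) : S.mult k i M = S.mult k i N :=
  (Linear.homCongr k (Iso.refl (S.X i)) e).finrank_eq

lemma mult_biprod (i : ι) (M N : C) : S.mult k i (M ⊞ N) = S.mult k i M + S.mult k i N :=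
  finrank_hom_biprod k _ _ _

lemma mult_X_of_ne {i j : ι} (h : i ≠ j) : S.mult k i (S.X j) = 0 :=
  finrank_hom_simple_simple_eq_zero_of_not_iso k fun e => h (S.eq_of_iso _ _ ⟨e⟩)

variable [IsAlgClosed k]

lemma mult_X_self (i : ι) : S.mult k i (S.X i) = 1 :=
  have := IsFusion.finite_hom (k := k) (C := C)
  finrank_endomorphism_simple_eq_one k (S.X i)

/-- `Hom(X i, M*) ≅ Hom(X i ⊗ M, I) ≅ Hom(M ⊗ X i, I) ≅ Hom(M, X i*)`, the middle step being the
braiding. With `i* = i` the last space has the dimension of `Hom(X i, M)`. -/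
lemma mult_dual [BraidedCategory C] {i : ι} (hi : S.star i = i) (M : C) :
    S.mult k i Mᘁ = S.mult k i M := by
  have hev : IsPerfect (S.ev i) := @isPerfect_evaluation C _ _ _ _ (S.pairing i)
  unfold mult
  rw [((isPerfect_evaluation M Mᘁ).homEquiv k _).finrank_eq,
    (Linear.homCongr k (β_ (S.X i) M) (Iso.refl (𝟙_ C))).finrank_eq,
    ← (hev.homEquiv k _).finrank_eq, finrank_hom_comm, hi]

include k in
omit [IsAlgClosed k] in
lemma exists_retract {M : C} (hM : ¬ IsZero M) :
    ∃ (i : ι) (f : S.X i ⟶ M) (r : M ⟶ S.X i), f ≫ r = 𝟙 _ := by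
  have : IsZero M ∨ ∃ (i : ι) (f : S.X i ⟶ M) (r : M ⟶ S.X i), f ≫ r = 𝟙 _ := by
    refine IsFusion.induction k
      (P := fun M => IsZero M ∨ ∃ (i : ι) (f : S.X i ⟶ M) (r : M ⟶ S.X i), f ≫ r = 𝟙 _)
      ?_ ?_ ?_ ?_ M
    · rintro A B e (h | ⟨i, f, r, h⟩)
      · exact Or.inl (h.of_iso e.symm)
      · exact Or.inr ⟨i, f ≫ e.hom, e.inv ≫ r, by simp [h]⟩
    · exact fun A h => Or.inl h
    · intro A hA
      obtain ⟨i, ⟨e⟩⟩ := S.exists_iso A hA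
      exact Or.inr ⟨i, e.inv, e.hom, e.inv_hom_id⟩
    · rintro A B (hA | ⟨i, f, r, h⟩) hB
      · rcases hB with hB | ⟨i, f, r, h⟩
        · exact Or.inl ((biprod_isZero_iff _ _).2 ⟨hA, hB⟩)
        · exact Or.inr ⟨i, f ≫ biprod.inr, biprod.snd ≫ r, by simp [h]⟩
      · exact Or.inr ⟨i, f ≫ biprod.inl, biprod.fst ≫ r, by simp [h]⟩
  exact this.resolve_left hM

include k in
omit [IsAlgClosed k] in
lemma K0_closure_eq_top (S : SimpleReps C ι) :
    AddSubgroup.closure (Set.range fun i => K0.cls (S.X i)) = ⊤ := by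
  rw [eq_top_iff]
  have key : ∀ M : C, K0.cls M ∈ AddSubgroup.closure (Set.range fun i => K0.cls (S.X i)) := by
    refine IsFusion.induction k ?_ ?_ ?_ ?_
    · intro A B e h
      rwa [← K0.cls_eq e]
    · intro A h
      rw [K0.cls_eq_zero_of_isZero h]
      exact zero_mem _
    · intro A h
      obtain ⟨i, ⟨e⟩⟩ := S.exists_iso A h
      rw [K0.cls_eq e]
      exact AddSubgroup.subset_closure ⟨i, rfl⟩
    · intro A B hA hB
      rw [K0.cls_biprod]
      exact add_mem hA hB
  rintro z -
  obtain ⟨z, rfl⟩ := QuotientAddGroup.mk'_surjective _ z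
  induction z using FreeAbelianGroup.induction_on with
  | zero => rw [map_zero]; exact zero_mem _
  | of R => exact key R
  | neg R hR => rw [map_neg]; exact neg_mem hR
  | add z z' hz hz' => rw [map_add]; exact add_mem hz hz'

/-! ### Forms on simple objects -/

section Simple

variable [BraidedCategory C]

lemma perfect_ev (i : ι) : IsPerfect (S.ev i) := @isPerfect_evaluation C _ _ _ _ (S.pairing i)

lemma ne_zero_of_perfect {Y X : C} [Simple Y] {e : Y ⊗ X ⟶ 𝟙_ C}
    (he : IsPerfect e) : e ≠ 0 := by
  intro h
  apply id_nonzero Y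
  apply (he Y).1
  simp [h]

/-- A nonzero pairing of simple objects is perfect. -/
lemma eq_star_and_perfect {i j : ι} {b : S.X j ⊗ S.X i ⟶ 𝟙_ C} (hb : b ≠ 0) :
    j = S.star i ∧ IsPerfect b := by
  -- `b` corresponds to a nonzero morphism `X j ⟶ X i*` of simple objects, hence to an isomorphism.
  obtain ⟨g, hg⟩ := (S.perfect_ev i (S.X j)).2 b
  simp only at hg
  have : g ≠ 0 := by
    rintro rfl
    apply hb
    rw [← hg, MonoidalPreadditive.zero_whiskerRight, zero_comp]
  have : IsIso g := isIso_of_hom_simple this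
  exact ⟨S.eq_of_iso _ _ ⟨asIso g⟩, hg ▸ (isPerfect_comp_iff (S.perfect_ev i) g).2 this⟩

include k in
/-- Two pairings of simple objects are proportional. -/
lemma exists_smul_eq {Y X : C} [Simple Y] {e : Y ⊗ X ⟶ 𝟙_ C} (he : IsPerfect e)
    (b : Y ⊗ X ⟶ 𝟙_ C) : ∃ c : k, b = c • e := by
  have := IsFusion.finite_hom (k := k) (C := C)
  obtain ⟨g, rfl⟩ := (he Y).2 b
  obtain ⟨c, rfl⟩ := endomorphism_simple_eq_smul_id k g
  exact ⟨c, by simp [MonoidalLinear.smul_whiskerRight]⟩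

/-- The evaluation `X i ⊗ X i* ⟶ I`, where `X i** = X i`. -/
def evStar (i : ι) : S.X i ⊗ S.X (S.star i) ⟶ 𝟙_ C :=
  eqToHom (congrArg S.X (S.star_star i).symm) ▷ S.X (S.star i) ≫ S.ev (S.star i)

lemma perfect_evStar (i : ι) : IsPerfect (S.evStar i) :=
  (isPerfect_comp_iff (S.perfect_ev _) _).2 inferInstance

/-- `Hom(X i ⊗ X i*, I)` is a line spanned by `evStar i`, so `d i` is a coordinate on it. -/
lemma existsUnique_isSign : ∃! d : ι → k, S.IsSign d := by
  choose d hd using fun i => exists_smul_eq k (S.perfect_evStar i)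
    ((β_ (S.X i) (S.X (S.star i))).hom ≫ S.ev i)
  refine ⟨d, hd, fun d' hd' => funext fun i => ?_⟩
  have h : d' i • S.evStar i = d i • S.evStar i := (hd' i).symm.trans (hd i)
  exact smul_left_injective k (ne_zero_of_perfect (S.perfect_evStar i)) h

/-- The evaluation as a form on the self-dual object `X i = X i*`. -/
def selfEv {i : ι} (h : S.star i = i) : S.X i ⊗ S.X i ⟶ 𝟙_ C :=
  eqToHom (congrArg S.X h.symm) ▷ S.X i ≫ S.ev i

lemma perfect_selfEv {i : ι} (h : S.star i = i) : IsPerfect (S.selfEv h) :=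
  (isPerfect_comp_iff (S.perfect_ev _) _).2 inferInstance

/-- Stated for independent indices so that `h` can be substituted; the use is at `i = star i`, where
it cannot. -/
lemma ev_eqToHom {i j : ι} (h : i = j) :
    S.X (S.star i) ◁ eqToHom (congrArg S.X h) ≫
      eqToHom (congrArg (fun l => S.X (S.star l)) h) ▷ S.X j ≫ S.ev j = S.ev i := by
  subst h
  simp

-- The defining identity of `d i` is moved from `X i ⊗ X i*` to `X i ⊗ X i`, where `d i` becomes an
-- eigenvalue of the braiding acting on forms.
variable {k} in
lemma braiding_selfEv {d : ι → k} (hd : S.IsSign d) {i : ι} (h : S.star i = i) :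
    (β_ (S.X i) (S.X i)).hom ≫ S.selfEv h = d i • S.selfEv h := by
  unfold selfEv
  rw [← BraidedCategory.braiding_naturality_right_assoc, hd i, Linear.comp_smul]
  congr 1
  have := S.ev_eqToHom h.symm
  rw [← this, ← whisker_exchange_assoc, ← comp_whiskerRight_assoc, eqToHom_trans]

variable {k} in
/-- A nonsingular symmetric form on `X i` exists only if `i = i*` and `d i = 1`. -/
lemma index_of_qForm {d : ι → k} (hd : S.IsSign d) {i : ι} (q : QForm (S.X i)) :
    S.star i = i ∧ d i = 1 := by
  have h := (S.eq_star_and_perfect (ne_zero_of_perfect q.perfect)).1.symm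
  refine ⟨h, ?_⟩
  obtain ⟨c, hc⟩ := exists_smul_eq k q.perfect (S.selfEv h)
  have h1 := S.braiding_selfEv hd h
  have h0 := ne_zero_of_perfect (S.perfect_selfEv h)
  -- `selfEv` is a multiple of the symmetric form `q`, hence fixed by the braiding, which also
  -- scales it by `d i`.
  have h2 : S.selfEv h = d i • S.selfEv h := by
    rw [← h1, hc, Linear.comp_smul, q.symm]
  exact (smul_left_injective k h0 (by simpa using h2)).symm

variable {k} in
/-- The evaluation on `X i` as a nonsingular symmetric form. -/
def evForm {d : ι → k} (hd : S.IsSign d) {i : ι} (h : S.star i = i) (h1 : d i = 1) :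
    QForm (S.X i) where
  form := S.selfEv h
  symm := by rw [IsSymmetricForm, S.braiding_selfEv hd, h1, one_smul]
  nonsing := (isNonsingular_iff _).2 (S.perfect_selfEv h)

include k in
/-- Any two nonsingular symmetric forms on a simple object are isometric. -/
lemma cls_eq_of_simple {X : C} [Simple X] (q q' : QForm X) :
    Witt.cls ⟨X, q⟩ = Witt.cls ⟨X, q'⟩ := by
  obtain ⟨c, hc⟩ := exists_smul_eq k q'.perfect q.form
  -- Scaling `X` by `a` multiplies a form by `a²`, so `a² = c` turns `q'` into `q = c • q'`.
  obtain ⟨a, ha⟩ := IsAlgClosed.exists_pow_nat_eq c (n := 2) (by norm_num)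
  have hne : a ≠ 0 := by
    rintro rfl
    apply ne_zero_of_perfect q.perfect
    rw [hc, ← ha]
    simp
  refine Witt.cls_eq ⟨⟨a • 𝟙 X, a⁻¹ • 𝟙 X, ?_, ?_⟩, ?_⟩
  · simp [smul_smul, hne]
  · simp [smul_smul, hne]
  · simp [hc, ← ha, tensorHom_smul, smul_smul, pow_two]

include k in
/-- The Witt group is generated by the classes of simple quadratic objects. -/
lemma cls_mem_closure [CharZero k] (Q : QuadObj C) :
    Witt.cls Q ∈ AddSubgroup.closure
      {x | ∃ (i : ι) (q : QForm (S.X i)), x = Witt.cls ⟨S.X i, q⟩} := by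
  have := S.finite_index k
  have := Fintype.ofFinite ι
  -- The induction is on the length of `Q.obj`, the total multiplicity of simple objects.
  induction hn : ∑ i, S.mult k i Q.obj using Nat.strong_induction_on generalizing Q with
  | _ n ih =>
  -- Splitting off any non-singular `N` containing some `X i` leaves a strictly shorter complement.
  have split : ∀ {N : C} (q : QForm N) (f : N ⟶ Q.obj), (f ⊗ₘ f) ≫ Q.q.form = q.form →
      ∀ i, 0 < S.mult k i N → Witt.cls ⟨N, q⟩ ∈ AddSubgroup.closure
        {x | ∃ (i : ι) (q : QForm (S.X i)), x = Witt.cls ⟨S.X i, q⟩} →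
      Witt.cls Q ∈ AddSubgroup.closure
        {x | ∃ (i : ι) (q : QForm (S.X i)), x = Witt.cls ⟨S.X i, q⟩} := by
    intro N q f hf i hi hN
    obtain ⟨K, hK⟩ := exists_isometric_perp Q q f hf
    rw [Witt.cls_eq hK, Witt.cls_perp]
    refine add_mem hN (ih _ ?_ K rfl)
    obtain ⟨e, -⟩ := hK
    have : ∀ j, S.mult k j Q.obj = S.mult k j N + S.mult k j K.obj := fun j =>
      (S.mult_congr k j e).trans (S.mult_biprod k j _ _)
    rw [← hn]
    simp only [this, Finset.sum_add_distrib]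
    have := Finset.single_le_sum (f := fun j => S.mult k j N) (fun _ _ => Nat.zero_le _)
      (Finset.mem_univ i)
    omega
  by_cases h : ∃ (i : ι) (f : S.X i ⟶ Q.obj), (f ⊗ₘ f) ≫ Q.q.form ≠ 0
  · obtain ⟨i, f, hf⟩ := h
    let q : QForm (S.X i) :=
      { form := (f ⊗ₘ f) ≫ Q.q.form
        symm := by
          unfold IsSymmetricForm
          rw [← BraidedCategory.braiding_naturality_assoc, Q.q.symm]
        nonsing := (isNonsingular_iff _).2 (S.eq_star_and_perfect hf).2 }
    exact split q f rfl i (by rw [S.mult_X_self k]; exact one_pos)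
      (AddSubgroup.subset_closure ⟨i, q, rfl⟩)
  · push Not at h
    by_cases hz : IsZero Q.obj
    · rw [Witt.cls_eq_zero_of_isZero Q hz]
      exact zero_mem _
    obtain ⟨i, f, r, hfr⟩ := S.exists_retract k hz
    -- All simple subobjects are now isotropic. Non-singularity represents the retraction `r` by a
    -- morphism `y` from the dual, which therefore pairs with `f` by the evaluation.
    obtain ⟨y, hy⟩ := (Q.q.perfect (S.X i)ᘁ).2 ((S.X i)ᘁ ◁ r ≫ ε_ _ _)
    simp only at hy
    have hyf : (y ⊗ₘ f) ≫ Q.q.form = ε_ (S.X i) (S.X i)ᘁ := by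
      rw [tensorHom_def'_assoc, hy, ← whiskerLeft_comp_assoc, hfr]
      simp
    have hfy : (f ⊗ₘ y) ≫ Q.q.form = (β_ _ _).hom ≫ ε_ (S.X i) (S.X i)ᘁ := by
      rw [← hyf, ← BraidedCategory.braiding_naturality_assoc, Q.q.symm]
    -- The dual of `X i` is isomorphic to the simple object `X i*`, so isotropy applies to `y` as
    -- well.
    have hyy : (y ⊗ₘ y) ≫ Q.q.form = 0 := by
      let t : S.X (S.star i) ≅ (S.X i)ᘁ := rightDualIso (S.pairing i) inferInstance
      have := h _ (t.hom ≫ y)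
      rw [← tensorHom_comp_tensorHom_assoc] at this
      rwa [← cancel_epi (t.hom ⊗ₘ t.hom), comp_zero]
    have hw : IsWeaklySymmetric (S.X i) := by
      unfold IsWeaklySymmetric
      rw [← hfy, ← BraidedCategory.braiding_naturality_assoc, Q.q.symm, hyf]
    have hform : (biprod.desc f y ⊗ₘ biprod.desc f y) ≫ Q.q.form = hypForm (S.X i) := by
      have : biprod.desc f y = biprod.fst ≫ f + biprod.snd ≫ y := by
        apply biprod.hom_ext' <;> simp
      rw [this]
      simp only [MonoidalPreadditive.add_tensor, MonoidalPreadditive.tensor_add,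
        Preadditive.add_comp, ← tensorHom_comp_tensorHom, Category.assoc, h i f, hyf, hfy, hyy,
        comp_zero, add_zero, zero_add]
      rw [hypForm, add_comm]
    refine split (hyp (S.X i) hw).q (biprod.desc f y) hform i ?_ ?_
    · change 0 < S.mult k i (S.X i ⊞ (S.X i)ᘁ)
      rw [S.mult_biprod k, S.mult_X_self k]
      omega
    · have := Witt.cls_hyp hw
      rw [show (⟨_, (hyp (S.X i) hw).q⟩ : QuadObj C) = hyp (S.X i) hw from rfl, this]
      exact zero_mem _

end Simple

end SimpleReps

end Fusion

end BraidedWitt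

namespace BraidedWitt

universe v u w

set_option linter.unusedSectionVars false

namespace SimpleReps

/-! ### Parities of multiplicities and the basis of the Witt group. -/

section WittBasis

variable {k : Type*} [Field k] [IsAlgClosed k] [CharZero k] {C : Type u} [Category.{v} C]
  [Abelian C] [Linear k C] [MonoidalCategory C] [MonoidalPreadditive C] [MonoidalLinear k C]
  [BraidedCategory C] [RightRigidCategory C] [IsFusion k C] {ι : Type w} (S : SimpleReps C ι)

/-- The indices `i = i*` with sign `d i = 1`. -/
abbrev Orthogonal (d : ι → k) : Type w := {i : ι // S.star i = i ∧ d i = 1}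

/-- The multiplicities modulo two of the orthogonal simple objects in `M`. -/
noncomputable def parity (d : ι → k) (M : C) : S.Orthogonal d →₀ ZMod 2 :=
  have := S.finite_index k
  Finsupp.equivFunOnFinite.symm fun i => (S.mult k i M : ZMod 2)

variable (d : ι → k)

lemma parity_apply (M : C) (i : S.Orthogonal d) : S.parity d M i = (S.mult k i M : ZMod 2) := rfl

lemma parity_congr {M N : C} (e : M ≅ N) : S.parity d M = S.parity d N := by
  ext i
  rw [parity_apply, parity_apply, S.mult_congr k i e]

lemma parity_biprod (M N : C) : S.parity d (M ⊞ N) = S.parity d M + S.parity d N := by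
  ext i
  rw [Finsupp.add_apply, parity_apply, parity_apply, parity_apply, S.mult_biprod k, Nat.cast_add]

lemma parity_X (i : S.Orthogonal d) : S.parity d (S.X i) = Finsupp.single i 1 := by
  ext j
  rw [parity_apply]
  by_cases h : j = i
  · rw [h, S.mult_X_self k, Finsupp.single_eq_same, Nat.cast_one]
  · rw [S.mult_X_of_ne k (fun h' => h (Subtype.ext h')), Finsupp.single_eq_of_ne h, Nat.cast_zero]

lemma parity_X_of_not {j : ι} (hj : ¬ (S.star j = j ∧ d j = 1)) : S.parity d (S.X j) = 0 := by
  ext i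
  rw [parity_apply, S.mult_X_of_ne k (fun h : i.1 = j => hj (h ▸ i.2)), Nat.cast_zero, Finsupp.zero_apply]

/-- The simple objects counted are self-dual, so each occurs equally often in `M` and `Mᘁ`. -/
lemma parity_hyp {M : C} (hM : IsWeaklySymmetric M) : S.parity d (hyp M hM).obj = 0 := by
  change S.parity d (M ⊞ Mᘁ) = 0
  ext i
  rw [parity_apply, S.mult_biprod k, S.mult_dual k i.2.1, Nat.cast_add, CharTwo.add_self_eq_zero,
    Finsupp.zero_apply]

/-- The parity map on the Witt group. -/
noncomputable def wittParity : Witt C →+ (S.Orthogonal d →₀ ZMod 2) :=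
  QuotientAddGroup.lift (hypSubgroup C)
    (KZero.lift (fun Q => S.parity d Q.obj) (fun _ _ ⟨e, _⟩ => S.parity_congr d e)
      (fun Q Q' => S.parity_biprod d Q.obj Q'.obj)) (by
    refine (AddSubgroup.closure_le _).2 ?_
    rintro _ ⟨M, hM, rfl⟩
    exact (KZero.lift_cls _ _ _ _).trans (S.parity_hyp d hM))

lemma wittParity_cls (Q : QuadObj C) : S.wittParity d (Witt.cls Q) = S.parity d Q.obj :=
  KZero.lift_cls (r := Isometric) (s := perp) (fun Q : QuadObj C => S.parity d Q.obj)
    (fun _ _ ⟨e, _⟩ => S.parity_congr d e) (fun Q Q' => S.parity_biprod d Q.obj Q'.obj) Q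

/-- The parity map on `K₀`. -/
noncomputable def k0Parity : K0 C →+ (S.Orthogonal d →₀ ZMod 2) :=
  KZero.lift (fun M : C => S.parity d M) (fun _ _ ⟨e⟩ => S.parity_congr d e)
    (fun M N => S.parity_biprod d M N)

lemma k0Parity_cls (M : C) : S.k0Parity d (K0.cls M) = S.parity d M :=
  KZero.lift_cls (fun M : C => S.parity d M) _ _ M

variable (k C) in
include k in
lemma witt_two_nsmul (x : Witt C) : 2 • x = 0 := by
  have : nsmulAddMonoidHom (α := Witt C) 2 = 0 := Witt.hom_ext fun Q => by
    rw [nsmulAddMonoidHom_apply, two_nsmul, Witt.cls_add_self k, AddMonoidHom.zero_apply]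
  exact DFunLike.congr_fun this x

variable {d}

/-- The classes of the orthogonal simple objects form a basis of the Witt group. -/
noncomputable def wittBasis [Module (ZMod 2) (Witt C)] (hd : S.IsSign d) :
    Module.Basis (S.Orthogonal d) (ZMod 2) (Witt C) :=
  Module.Basis.ofRepr
    { (S.wittParity d).toZModLinearMap 2 with
      invFun := Finsupp.linearCombination (ZMod 2) fun i : S.Orthogonal d =>
        Witt.cls ⟨S.X i, S.evForm hd i.2.1 i.2.2⟩
      left_inv := by
        intro x
        change Finsupp.linearCombination (ZMod 2) (fun i : S.Orthogonal d =>
          Witt.cls ⟨S.X i, S.evForm hd i.2.1 i.2.2⟩) (S.wittParity d x) = x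
        -- Both sides are additive, so it suffices to compare them on the simple generators of
        -- `cls_mem_closure`; the index of such a generator is automatically orthogonal.
        have : ((Finsupp.linearCombination (ZMod 2) fun i : S.Orthogonal d =>
            Witt.cls ⟨S.X i, S.evForm hd i.2.1 i.2.2⟩).toAddMonoidHom).comp (S.wittParity d) =
            AddMonoidHom.id _ := Witt.hom_ext fun Q => by
          refine AddMonoidHom.eqOn_closure (s := _) ?_ (S.cls_mem_closure k Q)
          rintro _ ⟨i, q, rfl⟩
          have hi := S.index_of_qForm hd q
          change Finsupp.linearCombination (ZMod 2) _ (S.wittParity d _) = _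
          rw [wittParity_cls, S.parity_X d ⟨i, hi⟩, Finsupp.linearCombination_single, one_smul]
          have := S.simple i
          exact cls_eq_of_simple k _ _
        exact DFunLike.congr_fun this x
      right_inv := by
        intro x
        change S.wittParity d (Finsupp.linearCombination (ZMod 2) _ x) = x
        induction x using Finsupp.induction_linear with
        | zero => rw [map_zero, map_zero]
        | add x y hx hy => rw [map_add, map_add, hx, hy]
        | single i a =>
          rw [Finsupp.linearCombination_single, ZMod.map_smul, wittParity_cls, parity_X,
            Finsupp.smul_single, smul_eq_mul, mul_one] }

lemma wittBasis_repr [Module (ZMod 2) (Witt C)] (hd : S.IsSign d) (Q : QuadObj C) :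
    (S.wittBasis hd).repr (Witt.cls Q) = S.parity d Q.obj := S.wittParity_cls d Q

/-- Coordinates see only the underlying object, so the choice of form on `X i` is immaterial. -/
lemma wittBasis_apply [Module (ZMod 2) (Witt C)] (hd : S.IsSign d) (i : S.Orthogonal d)
    (q : QForm (S.X i)) : S.wittBasis hd i = Witt.cls ⟨S.X i, q⟩ := by
  apply (S.wittBasis hd).repr.injective
  rw [Module.Basis.repr_self, wittBasis_repr, parity_X]

/-! ### Comparison with `K₀(C) ⊗ ℤ/2` and the product. -/

variable (d) in
/-- The map from `K₀(C) ⊗ ℤ/2` to the multiplicities modulo two of the orthogonal simples. -/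
noncomputable def tensorParity : K0 C ⊗[ℤ] ZMod 2 →+ (S.Orthogonal d →₀ ZMod 2) :=
  TensorProduct.liftAddHom
    ((smulAddHom (ZMod 2) (S.Orthogonal d →₀ ZMod 2)).flip.comp (S.k0Parity d)) (by
      intro r x a
      change a • S.k0Parity d (r • x) = (r • a) • S.k0Parity d x
      rw [map_zsmul, smul_comm, smul_assoc])

lemma tensorParity_tmul (M : C) (a : ZMod 2) :
    S.tensorParity d (K0.cls M ⊗ₜ[ℤ] a) = a • S.parity d M := by
  change a • S.k0Parity d (K0.cls M) = _
  rw [k0Parity_cls]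

variable (d) in
/-- The section of `tensorParity` that sends the basis element `i` to the class of `X i`. -/
noncomputable def tensorIncl : (S.Orthogonal d →₀ ZMod 2) →+ K0 C ⊗[ℤ] ZMod 2 :=
  Finsupp.liftAddHom fun i => (TensorProduct.mk ℤ (K0 C) (ZMod 2) (K0.cls (S.X i))).toAddMonoidHom

lemma tensorIncl_single (i : S.Orthogonal d) (a : ZMod 2) :
    S.tensorIncl d (Finsupp.single i a) = K0.cls (S.X i) ⊗ₜ[ℤ] a := by
  rw [tensorIncl, Finsupp.liftAddHom_apply_single]
  rfl

lemma tensorParity_tensorIncl (x : S.Orthogonal d →₀ ZMod 2) :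
    S.tensorParity d (S.tensorIncl d x) = x := by
  induction x using Finsupp.induction_linear with
  | zero => rw [map_zero, map_zero]
  | add x y hx hy => rw [map_add, map_add, hx, hy]
  | single i a =>
    rw [tensorIncl_single, tensorParity_tmul, parity_X, Finsupp.smul_single, smul_eq_mul, mul_one]

variable (d) in
/-- The subgroup spanned by the simple objects that are not orthogonal. -/
noncomputable def nonorthogonal : AddSubgroup (K0 C ⊗[ℤ] ZMod 2) :=
  AddSubgroup.closure {z | ∃ j, ¬ (S.star j = j ∧ d j = 1) ∧
    z = K0.cls (S.X j) ⊗ₜ[ℤ] (1 : ZMod 2)}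

-- By additivity only `[X j] ⊗ a` matters: for orthogonal `j` the difference vanishes, for other `j`
-- the parity does. This gives the harder inclusion for the kernel.
variable (d) in
lemma sub_tensorIncl_mem (z : K0 C ⊗[ℤ] ZMod 2) :
    z - S.tensorIncl d (S.tensorParity d z) ∈ S.nonorthogonal d := by
  induction z using TensorProduct.induction_on with
  | zero => simp
  | add x y hx hy =>
    rw [map_add, map_add, add_sub_add_comm]
    exact add_mem hx hy
  | tmul x a =>
    have hx : x ∈ AddSubgroup.closure (Set.range fun i => K0.cls (S.X i)) := by
      rw [S.K0_closure_eq_top k]; trivial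
    induction hx using AddSubgroup.closure_induction with
    | zero => simp
    | add x y _ _ hx hy =>
      rw [TensorProduct.add_tmul, map_add, map_add, add_sub_add_comm]
      exact add_mem hx hy
    | neg x _ hx =>
      rw [TensorProduct.neg_tmul, map_neg, map_neg, neg_sub_neg, ← neg_sub]
      exact neg_mem hx
    | mem x hx =>
      obtain ⟨j, rfl⟩ := hx
      simp only
      rw [tensorParity_tmul]
      by_cases hj : S.star j = j ∧ d j = 1
      · rw [S.parity_X d ⟨j, hj⟩, Finsupp.smul_single,
          smul_eq_mul, mul_one, tensorIncl_single, sub_self]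
        exact zero_mem _
      · rw [S.parity_X_of_not d hj, smul_zero, map_zero, sub_zero]
        -- `nonorthogonal` is only an additive subgroup, so the coefficient is lifted to an integer
        -- multiple of the generator.
        obtain ⟨n, rfl⟩ := ZMod.intCast_surjective a
        have : (K0.cls (S.X j)) ⊗ₜ[ℤ] (n : ZMod 2) = n • ((K0.cls (S.X j)) ⊗ₜ[ℤ] (1 : ZMod 2)) := by
          rw [← TensorProduct.tmul_smul, zsmul_one]
        rw [this]
        refine zsmul_mem (?_ : _ ∈ AddSubgroup.closure _) n
        exact AddSubgroup.subset_closure ⟨j, hj, rfl⟩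

variable (d) in
lemma tensorParity_ker : (S.tensorParity d).ker = S.nonorthogonal d := by
  apply le_antisymm
  · intro z hz
    have := S.sub_tensorIncl_mem d z
    rwa [AddMonoidHom.mem_ker.1 hz, map_zero, sub_zero] at this
  · refine (AddSubgroup.closure_le _).2 ?_
    rintro _ ⟨j, hj, rfl⟩
    exact (S.tensorParity_tmul _ _).trans (by rw [S.parity_X_of_not d hj, smul_zero])

/-- The product of the Witt group is induced by the product of the Grothendieck ring. -/
lemma wittBasis_repr_mul [Module (ZMod 2) (Witt C)] (hd : S.IsSign d) (h : IsSymmetricBraiding C)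
    (x y : Witt C) : (S.wittBasis hd).repr (Witt.mulHom h x y) =
      S.tensorParity d (S.tensorIncl d ((S.wittBasis hd).repr x) *
        S.tensorIncl d ((S.wittBasis hd).repr y)) := by
  obtain ⟨u, rfl⟩ := (S.wittBasis hd).repr.symm.surjective x
  obtain ⟨v, rfl⟩ := (S.wittBasis hd).repr.symm.surjective y
  rw [LinearEquiv.apply_symm_apply, LinearEquiv.apply_symm_apply]
  -- Both sides are biadditive and coefficients are 0 or 1, so only products of two basis vectors
  -- remain; there both sides are the parity of `X i ⊗ X j`.
  have two : ∀ a : ZMod 2, a = 0 ∨ a = 1 := by decide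
  induction u using Finsupp.induction_linear with
  | zero => simp
  | add u u' hu hu' =>
    rw [map_add, map_add, AddMonoidHom.add_apply, map_add, map_add, add_mul, map_add, hu, hu']
  | single i a =>
    rcases two a with rfl | rfl
    · simp
    induction v using Finsupp.induction_linear with
    | zero => simp
    | add v v' hv hv' => rw [map_add, map_add, map_add, map_add, mul_add, map_add, hv, hv']
    | single j b =>
      rcases two b with rfl | rfl
      · simp
      rw [Module.Basis.repr_symm_single_one, Module.Basis.repr_symm_single_one,
        S.wittBasis_apply hd i (S.evForm hd i.2.1 i.2.2),
        S.wittBasis_apply hd j (S.evForm hd j.2.1 j.2.2), Witt.mulHom_cls, wittBasis_repr,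
        tensorIncl_single, tensorIncl_single, Algebra.TensorProduct.tmul_mul_tmul, mul_one]
      exact ((S.tensorParity_tmul _ _).trans (one_smul _ _)).symm

end WittBasis

end SimpleReps

end BraidedWitt

theorem mainTheorem1 {k : Type*} [Field k] [IsAlgClosed k] [CharZero k]
    {C : Type*} [Category* C] [Abelian C] [Linear k C]
    [MonoidalCategory C] [MonoidalPreadditive C] [MonoidalLinear k C]
    [BraidedCategory C] [RightRigidCategory C] [BraidedWitt.IsFusion k C]
    {ι : Type*} (S : BraidedWitt.SimpleReps C ι) :
    -- the scalars `d_i` exist and are unique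
    (∃! d : ι → k, S.IsSign d) ∧
    ∀ d : ι → k, S.IsSign d →
      -- `W(C)` is a `ℤ/2`-vector space with basis the `X_i` with `i = i*` and `d_i = 1`
      ∃ (_ : Module (ZMod 2) (BraidedWitt.Witt C))
        (B : Module.Basis {i : ι // S.star i = i ∧ d i = 1} (ZMod 2) (BraidedWitt.Witt C)),
        (∀ i : {i : ι // S.star i = i ∧ d i = 1},
          (∃ q : BraidedWitt.QForm (S.X i),
            q.form = eqToHom (congrArg S.X i.2.1.symm) ▷ S.X i ≫ S.ev i) ∧
          ∀ q : BraidedWitt.QForm (S.X i), B i = BraidedWitt.Witt.cls ⟨S.X i, q⟩) ∧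
        -- for a symmetric braiding, `x · y = p (x y)`
        ∀ h : BraidedWitt.IsSymmetricBraiding C,
          ∃ (incl : BraidedWitt.Witt C →+ BraidedWitt.K0 C ⊗[ℤ] ZMod 2)
            (p : BraidedWitt.K0 C ⊗[ℤ] ZMod 2 →+ BraidedWitt.Witt C),
            (∀ i, incl (B i) = BraidedWitt.K0.cls (S.X i) ⊗ₜ[ℤ] (1 : ZMod 2)) ∧
            (∀ x, p (incl x) = x) ∧
            p.ker = AddSubgroup.closure {z | ∃ j, ¬ (S.star j = j ∧ d j = 1) ∧
              z = BraidedWitt.K0.cls (S.X j) ⊗ₜ[ℤ] (1 : ZMod 2)} ∧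
            ∀ x y, BraidedWitt.Witt.mulHom h x y = p (incl x * incl y) := by
  refine ⟨S.existsUnique_isSign k, fun d hd => ?_⟩
  let _ : Module (ZMod 2) (BraidedWitt.Witt C) :=
    AddCommGroup.zmodModule (BraidedWitt.SimpleReps.witt_two_nsmul k C)
  refine ⟨inferInstance, S.wittBasis hd,
    fun i => ⟨⟨S.evForm hd i.2.1 i.2.2, rfl⟩, S.wittBasis_apply hd i⟩, fun h => ?_⟩
  -- Both maps are the coordinate maps transported along the basis isomorphism; in particular `p`
  -- and `tensorParity` have the same kernel.
  refine ⟨(S.tensorIncl d).comp (S.wittBasis hd).repr.toAddMonoidHom,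
    (S.wittBasis hd).repr.symm.toAddMonoidHom.comp (S.tensorParity d), ?_, ?_, ?_, ?_⟩
  · intro i
    change S.tensorIncl d ((S.wittBasis hd).repr (S.wittBasis hd i)) = _
    rw [Module.Basis.repr_self, BraidedWitt.SimpleReps.tensorIncl_single]
  · intro x
    change (S.wittBasis hd).repr.symm (S.tensorParity d (S.tensorIncl d _)) = x
    rw [BraidedWitt.SimpleReps.tensorParity_tensorIncl]
    exact (S.wittBasis hd).repr.symm_apply_apply x
  · refine Eq.trans ?_ (S.tensorParity_ker d)
    ext z
    exact (S.wittBasis hd).repr.symm.map_eq_zero_iff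
  · intro x y
    change _ = (S.wittBasis hd).repr.symm (S.tensorParity d (S.tensorIncl d
      ((S.wittBasis hd).repr x) * S.tensorIncl d ((S.wittBasis hd).repr y)))
    rw [← S.wittBasis_repr_mul hd h, LinearEquiv.symm_apply_apply]
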